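/- **Setting.** Let $\Sigma$ be a real affine plane, $\Pi$ a real vector space with $\dim\Pi=2$, $\xi,\tau$ two linearly independent constant $1$-forms on $\Sigma$, $c\in\Pi\smallsetminus\{0\}$, and $\Omega\neq0$ a skew-symmetric bilinear form on $\Pi$. Let $X$ be the radial vector field on $\Pi$ (the identity map $\Pi\to\Pi$), $\phi=\Omega(X,c)$, and $\Pi_+\subset\Pi$ the open half-plane on which $\phi>0$. On $\Sigma\times\Pi_+$ let $V$ and $H$ be the distributions tangent to the factors $\Pi_+$ and $\Sigma$; for $w$ tangent to $\Sigma$ let $Y_w=\xi(w)X+\tau(w)c$, and for vertical $v$ let $h(v,w)=\Omega(Y_w,v)$ and $h(v,\cdot)=0$ on $V$. Put $\beta=\phi^{-2}\xi$, $\zeta=2\phi^{-1}\,\xi\wedge\tau$ (where $\xi\wedge\tau=\xi\otimes\tau-\tau\otimes\xi$) and, on $V$, $\alpha=-d\log\phi$, $\theta=\phi^2\Omega$. Let $\zeta w=-2\phi^{-2}Y_w$ be the vertical vector field with $h(\zeta w,\cdot)=\zeta(w,\cdot)$. Let $K\in\mathbb R$, let $U\subset\Sigma$ be open, and let $F$ be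 a bundle morphism over $U\times\Pi_+$ from the tangent bundle to $V$, vanishing on $V$. Let $H+F=\{w+Fw: w\in H\}$. Denote by $g$ the unique symmetric $2$-tensor extending $h$ for which $H+F$ is null, by $\nabla$ its Levi-Civita connection, and by $R$ its curvature tensor, $R(u,v)w=\nabla_v\nabla_uw-\nabla_u\nabla_vw+\nabla_{[u,v]}w$. Let $\gamma$ be the $1$-form with $g(\nabla_uw,w')=-\gamma(u)\,\zeta(w,w')$ for all vector fields $u$ and sections $w,w'$ of $H+F$, and extend $\alpha,\theta$ to forms on $U\times\Pi_+$ by $\alpha(w)=2\gamma(\zeta w)$, $\theta(w,\cdot)=0$ for sections $w$ of $H+F$. Consider the following conditions, in which $u,v$ are arbitrary sections of $V$ and $w$ of $H+F$: - (a) $R(w,u)v=K\,h(v,w)\,u$; - (b) $d\beta+2\beta\wedge\alpha=-K\zeta/2$; - (c) $[\nabla_w\theta](u,v)=-2\alpha(w)\,\theta(u,v)$; - (d) $(d\gamma+2\alpha\wedge\gamma)(\cdot,w)=g(\cdot,w)/2$. **Theorem.** Suppose that $H+F$ satisfies (a), (b) and (c), and that $F=F^K+F^q+F^\lambda+F^\mu+f\zeta$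 on $U\times\Pi_+$ for a $C^\infty$ function $(q,\lambda,\mu,r):U\to\Pi\times[\Pi^*]^{\odot2}\times[\Pi^*]^{\odot2}\times\mathbb R$, where $$F^Kw=\tfrac12K\phi\,\tau(w)X,\qquad F^qw=2\xi(w)q-\Omega(q,c)\phi^{-1}Y_w,$$ $$F^\lambda w=\phi^{-1}[\xi(w)\lambda(X,X)c+\tau(w)\lambda(c,c)X],\qquad F^\mu w=\phi^{-1}[\mu(X,X)Y_w-2\mu(Y_w,X)X],$$ $$f=r\phi^3+\tfrac14[\lambda(c,X)-\mu(X,X)-\Omega(q,c)]\,\phi .$$ Let $a\in\Pi$ be such that $\Omega(a,c)=1$. Then $H+F$ satisfies (d) if and only if there is a $C^\infty$ function $s:U\to\mathbb R$ for which, on $U\times\Pi_+$, $$[2\mu_1(X,X)-\lambda_2(X,X)]\,\phi=4\lambda(c,X)\mu(X,X)-4\mu(c,X)\lambda(X,X)-2K\phi^2\Omega(X,q),$$ $$\lambda_1(c,X)+2\Omega(X,q_2)=4\mu(q,X)+\Omega(X,a)-\phi\,{\det}_\Omega\lambda-s\phi,$$ and, on $U$, $$K\Omega(q_1,c)+s_2=2K\lambda(c,q)+8r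 .$$ Here the subscripts $1,2$ denote the partial derivatives with respect to the affine coordinates $y^1,y^2$ on $\Sigma$ with $dy^1=\xi$ and $dy^2=\tau$, and ${\det}_\Omega\lambda$ is the ratio $(\det\Omega)^{-1}\det\lambda$ of determinants of bilinear forms evaluated in any basis of $\Pi$. -/

import Mathlib

open Set
open scoped ContDiff

noncomputable section

/-! ### Calculus on affine spaces -/

/-- Derivative at `x` of a map `f` defined on an affine space `Q` with the translation vector
space `W`.  It is the derivative at `0` of `u ↦ f (x + u)`. -/
def affDeriv {W Q G : Type*} [NormedAddCommGroup W] [NormedSpace ℝ W] [AddTorsor W Q]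
    [NormedAddCommGroup G] [NormedSpace ℝ G] (f : Q → G) (x : Q) : W →L[ℝ] G :=
  fderiv ℝ (fun u : W => f (u +ᵥ x)) 0

/-- `C^∞` differentiability, at all points of `A`, of a map defined on an affine space
(used for open sets `A` only). -/
def AffSmoothOn {W Q G : Type*} [NormedAddCommGroup W] [NormedSpace ℝ W] [AddTorsor W Q]
    [NormedAddCommGroup G] [NormedSpace ℝ G] (f : Q → G) (A : Set Q) : Prop :=
  ∀ x ∈ A, ContDiffAt ℝ ∞ (fun u : W => f (u +ᵥ x)) 0

/-- The exterior derivative `(dη)(u, v) = d_u[η(v)] - d_v[η(u)] - η([u,v])` of a `1`-form on an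
affine space, evaluated on vectors `u, v` extended to constant (hence commuting) fields. -/
def extDerivOne {W Q : Type*} [NormedAddCommGroup W] [NormedSpace ℝ W] [AddTorsor W Q]
    (η : Q → W → ℝ) (p : Q) (u v : W) : ℝ :=
  affDeriv (fun p' => η p' v) p u - affDeriv (fun p' => η p' u) p v

/-- The exterior product `β ∧ α = β ⊗ α - α ⊗ β` of two linear functionals. -/
def wedgeOne {W : Type*} (β α : W → ℝ) (u v : W) : ℝ := β u * α v - α u * β v

/-- A two-plane system `(Σ, ξ, τ, Π, c, Ω)`.  Here `E` is the translation space of the affine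
plane `Σ`, so that constant `1`-forms on `Σ` are functionals on `E`, and `P` is the vector plane
`Π`.  (Any norm may be used on the finite-dimensional spaces `E`, `P`.) -/
structure TwoPlaneSystem (E P : Type*) [NormedAddCommGroup E] [NormedSpace ℝ E]
    [NormedAddCommGroup P] [NormedSpace ℝ P] where
  finrank_base : Module.finrank ℝ E = 2
  finrank_fibre : Module.finrank ℝ P = 2
  xi : E →L[ℝ] ℝ
  tau : E →L[ℝ] ℝ
  linearIndependent : LinearIndependent ℝ ![xi, tau]
  c : P
  c_ne_zero : c ≠ 0
  Omega : P →L[ℝ] P →L[ℝ] ℝ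
  Omega_self : ∀ v, Omega v v = 0
  Omega_ne_zero : Omega ≠ 0

namespace TwoPlaneSystem

variable {E P S : Type*} [NormedAddCommGroup E] [NormedSpace ℝ E]
  [NormedAddCommGroup P] [NormedSpace ℝ P]

/-! ### The dual basis of `ξ, τ`, and the associated basic octuple -/

theorem exists_vec (T : TwoPlaneSystem E P) (a b : ℝ) : ∃ w : E, T.xi w = a ∧ T.tau w = b := by
  have : FiniteDimensional ℝ E := Module.finite_of_finrank_pos (by rw [T.finrank_base]; norm_num)
  let L : E →ₗ[ℝ] ℝ × ℝ := (T.xi : E →ₗ[ℝ] ℝ).prod (T.tau : E →ₗ[ℝ] ℝ)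
  have hL : Function.Surjective L := by
    rw [← LinearMap.dualMap_injective_iff, ← LinearMap.ker_eq_bot, LinearMap.ker_eq_bot']
    intro m hm
    have hli := LinearIndependent.pair_iff.1 T.linearIndependent (m (1, 0)) (m (0, 1)) (by
      ext w
      have h1 : m (L w) = 0 := by
        have := LinearMap.congr_fun hm w
        simpa using this
      have h2 : L w = T.xi w • ((1 : ℝ), (0 : ℝ)) + T.tau w • ((0 : ℝ), (1 : ℝ)) := by
        simp [L]
      rw [h2, map_add, map_smul, map_smul] at h1
      simp only [smul_eq_mul] at h1
      simp only [add_apply, smul_apply, smul_eq_mul,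
        zero_apply]
      linarith)
    ext
    · simpa using hli.1
    · simpa using hli.2
  obtain ⟨w, hw⟩ := hL (a, b)
  exact ⟨w, congrArg Prod.fst hw, congrArg Prod.snd hw⟩

/-- The first vector `∂₁` of the basis of `E` dual to `ξ, τ`. -/
def d1 (T : TwoPlaneSystem E P) : E := (T.exists_vec 1 0).choose

/-- The second vector `∂₂` of the basis of `E` dual to `ξ, τ`. -/
def d2 (T : TwoPlaneSystem E P) : E := (T.exists_vec 0 1).choose

theorem d1_spec (T : TwoPlaneSystem E P) : T.xi T.d1 = 1 ∧ T.tau T.d1 = 0 :=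
  (T.exists_vec 1 0).choose_spec

theorem d2_spec (T : TwoPlaneSystem E P) : T.xi T.d2 = 0 ∧ T.tau T.d2 = 1 :=
  (T.exists_vec 0 1).choose_spec

/-- The partial derivative `f₁` of a function `f` on `Σ`. -/
def pd1 {G : Type*} [NormedAddCommGroup G] [NormedSpace ℝ G] [AddTorsor E S]
    (T : TwoPlaneSystem E P) (f : S → G) (y : S) : G := affDeriv f y T.d1

/-- The partial derivative `f₂` of a function `f` on `Σ`. -/
def pd2 {G : Type*} [NormedAddCommGroup G] [NormedSpace ℝ G] [AddTorsor E S]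
    (T : TwoPlaneSystem E P) (f : S → G) (y : S) : G := affDeriv f y T.d2

/-- `φ = Ω(X, c)`, where `X` is the radial field. -/
def phi (T : TwoPlaneSystem E P) (x : P) : ℝ := T.Omega x T.c

/-- The open half-plane `Π₊` on which `Ω(·, c) > 0`. -/
def halfPlane (T : TwoPlaneSystem E P) : Set P := {x | 0 < T.phi x}

/-- `Y_w = ξ(w) X + τ(w) c`. -/
def Y (T : TwoPlaneSystem E P) (x : P) (w : E) : P := T.xi w • x + T.tau w • T.c

/-- The partial metric `h(v, w) = Ω(Y_w, v)`, for vertical `v` and for `w` tangent to `Σ`.  By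
definition `h` vanishes on pairs of vertical vectors, so that `h(v, z) = h(v, w)` whenever `w` is
the `Σ` component of a vector `z` tangent to `Σ × Π₊`. -/
def h (T : TwoPlaneSystem E P) (x : P) (v : P) (w : E) : ℝ := T.Omega (T.Y x w) v

/-- `β = φ⁻² ξ`. -/
def beta (T : TwoPlaneSystem E P) (p : S × P) (z : E × P) : ℝ := (T.phi p.2 ^ 2)⁻¹ * T.xi z.1

/-- `ζ = 2 φ⁻¹ ξ ∧ τ`. -/
def zeta (T : TwoPlaneSystem E P) (p : S × P) (z z' : E × P) : ℝ :=
  2 * (T.phi p.2)⁻¹ * wedgeOne T.xi T.tau z.1 z'.1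

/-- The vertical vector `ζw = -2 φ⁻² Y_w`, characterized by `h(ζw, w') = ζ(w, w')`. -/
def zetaVec (T : TwoPlaneSystem E P) (x : P) (w : E) : P := (-2 * (T.phi x ^ 2)⁻¹) • T.Y x w

theorem Omega_swap (T : TwoPlaneSystem E P) (u v : P) : T.Omega u v = -T.Omega v u := by
  have := T.Omega_self (u + v)
  simp only [map_add, add_apply, T.Omega_self] at this
  linarith

theorem h_zetaVec (T : TwoPlaneSystem E P) (p : S × P) (hp : p.2 ∈ T.halfPlane) (z z' : E × P) :
    T.h p.2 (T.zetaVec p.2 z.1) z'.1 = T.zeta p z z' := by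
  have h0 : T.phi p.2 ≠ 0 := ne_of_gt hp
  have h1 : T.Omega T.c p.2 = -T.phi p.2 := T.Omega_swap _ _
  have h2 : T.Omega p.2 T.c = T.phi p.2 := rfl
  simp only [h, zetaVec, zeta, wedgeOne, Y, map_add, map_smul, add_apply,
    smul_apply, T.Omega_self, smul_eq_mul, h1, h2]
  field_simp
  ring

/-! ### The geometry of a horizontal distribution

Vector fields on `Σ × Π₊` are maps into `E × P`.  The vertical vectors are `(0, v)`, and the
distribution `H` tangent to the factor `Σ` consists of the vectors `(w, 0)`.  A section `F` of the
bundle of morphisms valued in the vertical distribution `V` and vanishing on `V` is a map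
`F : Σ × P → (E →L[ℝ] P)`; the distribution `H + F` then consists of all `(w, F w)`. -/

/-- The section `w + F w` of `H + F`. -/
def lift (F : S × P → E →L[ℝ] P) (p : S × P) (w : E) : E × P := (w, F p w)

/-- The metric: the unique symmetric extension of `h` for which `H + F` is null. -/
def metric (T : TwoPlaneSystem E P) (F : S × P → E →L[ℝ] P) (p : S × P) (z z' : E × P) : ℝ :=
  T.h p.2 (z.2 - F p z.1) z'.1 + T.h p.2 (z'.2 - F p z'.1) z.1

theorem metric_vertical (T : TwoPlaneSystem E P) (F : S × P → E →L[ℝ] P) (p : S × P) (v : P)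
    (z : E × P) : T.metric F p (0, v) z = T.h p.2 v z.1 := by
  simp [metric, h, Y]

theorem metric_lift (T : TwoPlaneSystem E P) (F : S × P → E →L[ℝ] P) (p : S × P) (w w' : E) :
    T.metric F p (lift F p w) (lift F p w') = 0 := by
  simp [metric, lift, h]

/-- Raising an index with the metric: the vector `z` such that `g(z, ·) = ℓ`. -/
def sharp (T : TwoPlaneSystem E P) (F : S × P → E →L[ℝ] P) (p : S × P) (l : E × P → ℝ) : E × P :=
  lift F p ((T.phi p.2)⁻¹ • (l (0, T.c) • T.d1 - l (0, p.2) • T.d2)) +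
    (0, (T.phi p.2)⁻¹ • (l (lift F p T.d1) • T.c - l (lift F p T.d2) • p.2))

/-- The identity `φ v = Ω(v, c) X + Ω(X, v) c`, valid as `dim Π = 2`. -/
theorem phi_smul (T : TwoPlaneSystem E P) (x : P) (hx : x ∈ T.halfPlane) (v : P) :
    v = (T.phi x)⁻¹ • (T.Omega v T.c • x + T.Omega x v • T.c) := by
  have h0 : T.phi x ≠ 0 := ne_of_gt hx
  have h1 : T.Omega T.c x = -T.phi x := T.Omega_swap _ _
  have h2 : T.Omega x T.c = T.phi x := rfl
  have hfin : FiniteDimensional ℝ P :=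
    Module.finite_of_finrank_pos (by rw [T.finrank_fibre]; norm_num)
  have hli : LinearIndependent ℝ ![x, T.c] := by
    rw [LinearIndependent.pair_iff]
    intro s t hst
    have e1 := congrArg (fun z => T.Omega z T.c) hst
    have e2 := congrArg (fun z => T.Omega z x) hst
    simp only [map_add, map_smul, add_apply, smul_apply, T.Omega_self, smul_eq_mul, h1, h2,
      map_zero, zero_apply] at e1 e2
    constructor
    · simpa [h0] using e1
    · simpa [h0] using e2
  have hspan := hli.span_eq_top_of_card_eq_finrank (by simp [T.finrank_fibre])
  have hv : v ∈ Submodule.span ℝ (Set.range ![x, T.c]) := by rw [hspan]; trivial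
  rw [Matrix.range_cons, Matrix.range_cons, Matrix.range_empty, Set.union_empty,
    Set.singleton_union, Submodule.mem_span_pair] at hv
  obtain ⟨s, t, rfl⟩ := hv
  simp only [map_add, map_smul, add_apply, smul_apply, T.Omega_self, smul_eq_mul, h2]
  rw [smul_add, smul_smul, smul_smul]
  congr 2 <;> field_simp <;> ring

/-- The identity `w = ξ(w) ∂₁ + τ(w) ∂₂`. -/
theorem eq_d1_d2 (T : TwoPlaneSystem E P) (w : E) : w = T.xi w • T.d1 + T.tau w • T.d2 := by
  have hfin : FiniteDimensional ℝ E :=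
    Module.finite_of_finrank_pos (by rw [T.finrank_base]; norm_num)
  have hli : LinearIndependent ℝ ![T.d1, T.d2] := by
    rw [LinearIndependent.pair_iff]
    intro s t hst
    have e1 := congrArg T.xi hst
    have e2 := congrArg T.tau hst
    simp [T.d1_spec.1, T.d1_spec.2, T.d2_spec.1, T.d2_spec.2] at e1 e2
    exact ⟨e1, e2⟩
  have hspan := hli.span_eq_top_of_card_eq_finrank (by simp [T.finrank_base])
  have hv : w ∈ Submodule.span ℝ (Set.range ![T.d1, T.d2]) := by rw [hspan]; trivial
  rw [Matrix.range_cons, Matrix.range_cons, Matrix.range_empty, Set.union_empty,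
    Set.singleton_union, Submodule.mem_span_pair] at hv
  obtain ⟨s, t, rfl⟩ := hv
  simp [T.d1_spec.1, T.d1_spec.2, T.d2_spec.1, T.d2_spec.2]

theorem metric_sharp (T : TwoPlaneSystem E P) (F : S × P → E →L[ℝ] P) (p : S × P)
    (hp : p.2 ∈ T.halfPlane) (l : E × P →ₗ[ℝ] ℝ) (z : E × P) :
    T.metric F p (T.sharp F p l) z = l z := by
  have h0 : T.phi p.2 ≠ 0 := ne_of_gt hp
  have h1 : T.Omega T.c p.2 = -T.phi p.2 := T.Omega_swap _ _
  have h2 : T.Omega p.2 T.c = T.phi p.2 := rfl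
  obtain ⟨w, v⟩ := z
  have hz : ((w, v) : E × P) = T.xi w • lift F p T.d1 + T.tau w • lift F p T.d2 +
      ((T.phi p.2)⁻¹ * T.Omega (v - F p w) T.c) • ((0, p.2) : E × P) +
      ((T.phi p.2)⁻¹ * T.Omega p.2 (v - F p w)) • ((0, T.c) : E × P) := by
    have hv := T.phi_smul p.2 hp (v - F p w)
    have hw := T.eq_d1_d2 w
    ext
    · simpa [lift] using hw
    · have hFw : F p w = T.xi w • F p T.d1 + T.tau w • F p T.d2 := by
        conv_lhs => rw [hw]
        simp
      rw [smul_add, smul_smul, smul_smul] at hv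
      simp only [lift, Prod.snd_add, Prod.smul_snd]
      rw [← hFw, add_assoc, ← hv]
      abel
  rw [hz, map_add, map_add, map_add, map_smul, map_smul, map_smul, map_smul, ← hz]
  simp only [metric, sharp, lift, h, Y, Prod.fst_add, Prod.snd_add, add_zero, map_add, map_smul,
    map_sub, add_apply, smul_apply, sub_apply, T.d1_spec.1, T.d1_spec.2, T.d2_spec.1,
    T.d2_spec.2, add_sub_cancel_left, T.Omega_self, smul_eq_mul, h1, h2]
  rw [T.Omega_swap T.c v, T.Omega_swap T.c (F p w)]
  field_simp
  ring

/-- The Christoffel form of the Levi-Civita connection `∇` of the metric, relative to the flat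
connection of the affine space: the value of `∇_u v` for constant vector fields `u, v`, obtained
from the Koszul formula. -/
def christoffel [AddTorsor E S] (T : TwoPlaneSystem E P) (F : S × P → E →L[ℝ] P) (p : S × P) (u v : E × P) :
    E × P :=
  T.sharp F p fun w => (1 / 2 : ℝ) *
    (affDeriv (fun p' : S × P => T.metric F p' v w) p u
      + affDeriv (fun p' : S × P => T.metric F p' u w) p v
      - affDeriv (fun p' : S × P => T.metric F p' u v) p w)

/-- The Levi-Civita covariant derivative `∇_u Z` at `p` of a vector field `Z`. -/
def nabla [AddTorsor E S] (T : TwoPlaneSystem E P) (F : S × P → E →L[ℝ] P) (p : S × P)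
    (u : E × P) (Z : S × P → E × P) : E × P :=
  affDeriv Z p u + T.christoffel F p u (Z p)

/-- The curvature tensor `R(u, v) w = ∇_v ∇_u w - ∇_u ∇_v w + ∇_[u,v] w`, evaluated on vectors
`u, v, w` extended to constant vector fields. -/
def curvature [AddTorsor E S] (T : TwoPlaneSystem E P) (F : S × P → E →L[ℝ] P) (p : S × P) (u v w : E × P) :
    E × P :=
  T.nabla F p v (fun p' => T.nabla F p' u fun _ => w)
    - T.nabla F p u (fun p' => T.nabla F p' v fun _ => w)

/-- The `1`-form `γ` with `g(∇_u w', w'') = -γ(u) ζ(w', w'')` for all sections `w', w''` of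
`H + F`.  Both sides are skew-symmetric and valuewise in `w', w''`, and so `γ` is found by using
the sections arising from `∂₁, ∂₂`, for which `ζ(w', w'') = 2 φ⁻¹`. -/
def gamma [AddTorsor E S] (T : TwoPlaneSystem E P) (F : S × P → E →L[ℝ] P) (p : S × P) (u : E × P) : ℝ :=
  -(T.phi p.2 / 2) *
    T.metric F p (T.nabla F p u fun p' => lift F p' T.d1) (lift F p T.d2)

/-- The `1`-form `α` equal to `-d log φ` on `V`, and to `w ↦ 2 γ(ζw)` on `H + F`. -/
def alpha [AddTorsor E S] (T : TwoPlaneSystem E P) (F : S × P → E →L[ℝ] P) (p : S × P) (z : E × P) : ℝ :=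
  -(T.phi p.2)⁻¹ * T.Omega (z.2 - F p z.1) T.c + 2 * T.gamma F p (0, T.zetaVec p.2 z.1)

/-- The `2`-form `θ` equal to `φ² Ω` on `V` and having the kernel `H + F`. -/
def theta (T : TwoPlaneSystem E P) (F : S × P → E →L[ℝ] P) (p : S × P) (z z' : E × P) : ℝ :=
  T.phi p.2 ^ 2 * T.Omega (z.2 - F p z.1) (z'.2 - F p z'.1)

/-- The covariant derivative `[∇_z θ](u, v)`, evaluated on vectors `u, v` extended to constant
vector fields. -/
def nablaTheta [AddTorsor E S] (T : TwoPlaneSystem E P) (F : S × P → E →L[ℝ] P) (p : S × P) (z u v : E × P) : ℝ :=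
  affDeriv (fun p' : S × P => T.theta F p' u v) p z
    - T.theta F p (T.nabla F p z fun _ => u) v - T.theta F p u (T.nabla F p z fun _ => v)

/-! ### The four curvature conditions on `U × Π₊` -/

/-- Condition (a): `R(w, u) v = K h(v, w) u` for `u, v` in `V` and `w` in `H + F`. -/
def CondA [AddTorsor E S] (T : TwoPlaneSystem E P) (K : ℝ) (F : S × P → E →L[ℝ] P) (U : Set S) : Prop :=
  ∀ p ∈ U ×ˢ T.halfPlane, ∀ (w : E) (u v : P),
    T.curvature F p (lift F p w) (0, u) (0, v) = (K * T.h p.2 v w) • ((0, u) : E × P)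

/-- Condition (b): `dβ + 2 β ∧ α = -K ζ / 2`. -/
def CondB [AddTorsor E S] (T : TwoPlaneSystem E P) (K : ℝ) (F : S × P → E →L[ℝ] P) (U : Set S) : Prop :=
  ∀ p ∈ U ×ˢ T.halfPlane, ∀ z z' : E × P,
    extDerivOne (fun p' : S × P => T.beta p') p z z' + 2 * wedgeOne (T.beta p) (T.alpha F p) z z'
      = -K * T.zeta p z z' / 2

/-- Condition (c): `[∇_w θ](u, v) = -2 α(w) θ(u, v)` for `u, v` in `V` and `w` in `H + F`. -/
def CondC [AddTorsor E S] (T : TwoPlaneSystem E P) (F : S × P → E →L[ℝ] P) (U : Set S) : Prop :=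
  ∀ p ∈ U ×ˢ T.halfPlane, ∀ (w : E) (u v : P),
    T.nablaTheta F p (lift F p w) (0, u) (0, v)
      = -2 * T.alpha F p (lift F p w) * T.theta F p (0, u) (0, v)

/-- Condition (d): `(dγ + 2 α ∧ γ)(·, w) = g(·, w) / 2` for `w` in `H + F`. -/
def CondD [AddTorsor E S] (T : TwoPlaneSystem E P) (F : S × P → E →L[ℝ] P) (U : Set S) : Prop :=
  ∀ p ∈ U ×ˢ T.halfPlane, ∀ (z : E × P) (w : E),
    extDerivOne (T.gamma F) p z (lift F p w)
        + 2 * wedgeOne (T.alpha F p) (T.gamma F p) z (lift F p w)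
      = T.metric F p z (lift F p w) / 2

/-! ### The explicit sections -/

/-- `F^K w = K φ τ(w) X / 2`. -/
def FK (T : TwoPlaneSystem E P) (K : ℝ) (x : P) (w : E) : P := (K * T.phi x * T.tau w / 2) • x

/-- `F^q w = 2 ξ(w) q - (d_q φ) φ⁻¹ Y_w`, where `d_q φ = Ω(q, c)`. -/
def Fq (T : TwoPlaneSystem E P) (q x : P) (w : E) : P :=
  (2 * T.xi w) • q - (T.Omega q T.c * (T.phi x)⁻¹) • T.Y x w

/-- `F^λ w = φ⁻¹ [ξ(w) λ(X, X) c + τ(w) λ(c, c) X]`. -/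
def Flam (T : TwoPlaneSystem E P) (lam : P →L[ℝ] P →L[ℝ] ℝ) (x : P) (w : E) : P :=
  (T.phi x)⁻¹ • ((T.xi w * lam x x) • T.c + (T.tau w * lam T.c T.c) • x)

/-- `F^μ w = φ⁻¹ [μ(X, X) Y_w - 2 μ(Y_w, X) X]`. -/
def Fmu (T : TwoPlaneSystem E P) (mu : P →L[ℝ] P →L[ℝ] ℝ) (x : P) (w : E) : P :=
  (T.phi x)⁻¹ • (mu x x • T.Y x w - (2 * mu (T.Y x w) x) • x)

/-- `f = r φ³ + [λ(c, X) - μ(X, X) - d_q φ] φ / 4`. -/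
def f (T : TwoPlaneSystem E P) (q : P) (lam mu : P →L[ℝ] P →L[ℝ] ℝ) (r : ℝ) (x : P) : ℝ :=
  r * T.phi x ^ 3 + (lam T.c x - mu x x - T.Omega q T.c) * T.phi x / 4

/-- The value at `(y, x)` of `F^K + F^q + F^λ + F^μ + f ζ` on the vector `w`, where `q, λ, μ, r`
denote the values at `y` of the corresponding functions. -/
def explicitF (T : TwoPlaneSystem E P) (K : ℝ) (q : P) (lam mu : P →L[ℝ] P →L[ℝ] ℝ) (r : ℝ)
    (x : P) (w : E) : P :=
  T.FK K x w + T.Fq q x w + T.Flam lam x w + T.Fmu mu x w + T.f q lam mu r x • T.zetaVec x w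

/-- The ratio `(det Ω)⁻¹ det λ`, with the determinants of the bilinear forms evaluated in the
basis `b` of `Π`. -/
def detRatio (T : TwoPlaneSystem E P) (b : Module.Basis (Fin 2) ℝ P)
    (lam : P →L[ℝ] P →L[ℝ] ℝ) : ℝ :=
  (Matrix.of fun i j => T.Omega (b i) (b j)).det⁻¹ * (Matrix.of fun i j => lam (b i) (b j)).det

/-- Some basis of `Π`. -/
def fibreBasis (T : TwoPlaneSystem E P) : Module.Basis (Fin 2) ℝ P :=
  haveI : Module.Finite ℝ P :=
    Module.finite_of_finrank_pos (by rw [T.finrank_fibre]; norm_num)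
  Module.finBasisOfFinrankEq ℝ P T.finrank_fibre

/-- `det_Ω λ = (det Ω)⁻¹ det λ`, which does not depend on the basis used
(see `detOmega_eq_detRatio`). -/
def detOmega (T : TwoPlaneSystem E P) (lam : P →L[ℝ] P →L[ℝ] ℝ) : ℝ :=
  T.detRatio T.fibreBasis lam

theorem detOmega_eq_detRatio (T : TwoPlaneSystem E P) (b : Module.Basis (Fin 2) ℝ P)
    (lam : P →L[ℝ] P →L[ℝ] ℝ) : T.detOmega lam = T.detRatio b lam := by
  unfold detOmega
  set b₀ := T.fibreBasis
  have key : ∀ l : P →L[ℝ] P →L[ℝ] ℝ, (Matrix.of fun i j => l (b i) (b j)).det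
      = (b₀.toMatrix b).det ^ 2 * (Matrix.of fun i j => l (b₀ i) (b₀ j)).det := by
    intro l
    have e : ∀ i, b i = b₀.toMatrix b 0 i • b₀ 0 + b₀.toMatrix b 1 i • b₀ 1 := by
      intro i
      have := b₀.sum_toMatrix_smul_self b i
      rw [Fin.sum_univ_two] at this
      exact this.symm
    simp only [Matrix.det_fin_two, Matrix.of_apply]
    rw [e 0, e 1]
    simp only [map_add, map_smul, add_apply, smul_apply,
      smul_eq_mul]
    ring
  have hd : (b₀.toMatrix b).det ≠ 0 := by
    have h1 := congrArg Matrix.det (b₀.toMatrix_mul_toMatrix_flip b)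
    rw [Matrix.det_mul, Matrix.det_one] at h1
    exact left_ne_zero_of_mul_eq_one h1
  unfold detRatio
  rw [key, key, mul_inv]
  field_simp

end TwoPlaneSystem

end

/-! Write `φ = Ω(X, c)` and `ψ = Ω(a, X)`, so that `X = φ a + ψ c`, and let `w₁, w₂` be the sections
`∂₁ + F∂₁, ∂₂ + F∂₂` of `H + F`. The explicit `F` has four components. They are polynomial in `φ,
φ⁻¹, ψ`, with coefficients that are affine in nine functions on `U`: the components of `q, λ, μ` in
the basis `a, c`, and `r`. The theorem thus becomes a comparison of coefficients.

By Koszul's formula `γ` equals `(φ/2) h([w₁, w₂], ·)` on `H + F`, since `H + F` is null; on `V` it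
is an expression in `F` and its first fibre derivatives (`gamma_eq`). As one argument in (d) lies in
`H + F`, condition (d) at a point amounts to five scalar equations (`condD_at_iff`): four with the
other argument equal to `a` or `c`, and one on the pair `w₁, w₂`.

The first four are combinations of four functions on `U`. Three of these, `eqnAA`, `eqnAC`, `eqnCC`,
are the coefficients of `φ³, φ²ψ, φψ²` in the first equation of the theorem; `eqnC` is the
coefficient of `ψ` in the second. The system is triangular, so it says precisely that all four
vanish. The coefficient of `φ` in the second equation imposes no condition: it only determines `s`,
as `solS`.

The fifth equation, modulo the four functions and their derivatives along `Σ`, is `-(φ²/2) eqnS =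
0`, which is the third equation of the theorem with `s = solS` (`condD_at_explicit_iff`). Since `U`
is open, those derivatives vanish once the four functions do, and (d) becomes the vanishing of all
five expressions on `U` (`condD_explicit_iff`). -/

noncomputable section

namespace TwoPlaneSystem

variable {E P S : Type*} [NormedAddCommGroup E] [NormedSpace ℝ E]
  [NormedAddCommGroup P] [NormedSpace ℝ P]

/-! ### Coordinates on the fibre plane -/

/-- In the coordinates `Ω(·, c)`, `Ω(a, ·)`, a vector of `Π` is recovered when `Ω(a, c) = 1`. -/
theorem eq_smul_add_smul (T : TwoPlaneSystem E P) {a : P} (ha : T.Omega a T.c = 1) (v : P) :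
    v = T.Omega v T.c • a + T.Omega a v • T.c := by
  have h1 : T.phi a = 1 := ha
  have h := T.phi_smul a (by simp [halfPlane, h1]) v
  rwa [h1, inv_one, one_smul] at h

theorem Omega_eq_coord (T : TwoPlaneSystem E P) {a : P} (ha : T.Omega a T.c = 1) (u v : P) :
    T.Omega u v = T.Omega u T.c * T.Omega a v - T.Omega a u * T.Omega v T.c := by
  conv_lhs => rw [T.eq_smul_add_smul ha u, T.eq_smul_add_smul ha v]
  simp only [map_add, map_smul, add_apply, smul_apply, T.Omega_self, smul_eq_mul, ha,
    T.Omega_swap T.c a]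
  ring

theorem isOpen_halfPlane (T : TwoPlaneSystem E P) : IsOpen T.halfPlane :=
  isOpen_lt continuous_const (T.Omega.flip T.c).continuous

/-! ### Jets of functions on `Σ × Π₊` -/

/-- The functional with the given values of its coefficients relative to
`ξ, τ, Ω(·, c), Ω(a, ·)`. -/
def coframe (T : TwoPlaneSystem E P) (a : P) (d₁ d₂ dA dC : ℝ) : E × P →L[ℝ] ℝ :=
  (d₁ • T.xi + d₂ • T.tau).comp (ContinuousLinearMap.fst ℝ E P) +
    (dA • T.Omega.flip T.c + dC • T.Omega a).comp (ContinuousLinearMap.snd ℝ E P)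

@[simp] theorem coframe_apply (T : TwoPlaneSystem E P) (a : P) (d₁ d₂ dA dC : ℝ) (u : E × P) :
    T.coframe a d₁ d₂ dA dC u =
      d₁ * T.xi u.1 + d₂ * T.tau u.1 + (dA * T.Omega u.2 T.c + dC * T.Omega a u.2) := rfl

variable [AddTorsor E S]

/-- The function `f` on `Σ × Π` is differentiable at `p`, with the given partial derivatives
relative to the coordinates `y¹, y²` on `Σ` and `Ω(·, c), Ω(a, ·)` on `Π`. -/
def HasJet (T : TwoPlaneSystem E P) (a : P) (f : S × P → ℝ) (p : S × P) (d₁ d₂ dA dC : ℝ) :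
    Prop :=
  HasFDerivAt (fun u : E × P => f (u +ᵥ p)) (T.coframe a d₁ d₂ dA dC) 0

variable {T : TwoPlaneSystem E P} {a : P} {f g : S × P → ℝ} {p : S × P}
  {d₁ d₂ dA dC e₁ e₂ eA eC : ℝ}

namespace HasJet

theorem of_eq (hf : T.HasJet a f p d₁ d₂ dA dC) (h₁ : d₁ = e₁) (h₂ : d₂ = e₂) (hA : dA = eA)
    (hC : dC = eC) : T.HasJet a f p e₁ e₂ eA eC := by
  subst h₁ h₂ hA hC
  exact hf

theorem affDeriv_apply (hf : T.HasJet a f p d₁ d₂ dA dC) (u : E × P) :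
    affDeriv f p u =
      d₁ * T.xi u.1 + d₂ * T.tau u.1 + (dA * T.Omega u.2 T.c + dC * T.Omega a u.2) := by
  rw [affDeriv, HasFDerivAt.fderiv hf, coframe_apply]

theorem const (r : ℝ) : T.HasJet a (fun _ : S × P => r) p 0 0 0 0 := by
  refine (hasFDerivAt_const r (0 : E × P)).congr_fderiv ?_
  ext u <;> simp

theorem add (hf : T.HasJet a f p d₁ d₂ dA dC) (hg : T.HasJet a g p e₁ e₂ eA eC) :
    T.HasJet a (fun p' => f p' + g p') p (d₁ + e₁) (d₂ + e₂) (dA + eA) (dC + eC) := by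
  refine (HasFDerivAt.fun_add hf hg).congr_fderiv ?_
  ext u <;> simp <;> ring

theorem sub (hf : T.HasJet a f p d₁ d₂ dA dC) (hg : T.HasJet a g p e₁ e₂ eA eC) :
    T.HasJet a (fun p' => f p' - g p') p (d₁ - e₁) (d₂ - e₂) (dA - eA) (dC - eC) := by
  refine (HasFDerivAt.fun_sub hf hg).congr_fderiv ?_
  ext u <;> simp <;> ring

theorem neg (hf : T.HasJet a f p d₁ d₂ dA dC) :
    T.HasJet a (fun p' => -f p') p (-d₁) (-d₂) (-dA) (-dC) := by
  refine (HasFDerivAt.fun_neg hf).congr_fderiv ?_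
  ext u <;> simp <;> ring

theorem mul (hf : T.HasJet a f p d₁ d₂ dA dC) (hg : T.HasJet a g p e₁ e₂ eA eC) :
    T.HasJet a (fun p' => f p' * g p') p (d₁ * g p + f p * e₁) (d₂ * g p + f p * e₂)
      (dA * g p + f p * eA) (dC * g p + f p * eC) := by
  refine (HasFDerivAt.mul hf hg).congr_fderiv ?_
  ext u <;> simp <;> ring

theorem inv (hf : T.HasJet a f p d₁ d₂ dA dC) (h0 : f p ≠ 0) :
    T.HasJet a (fun p' => (f p')⁻¹) p (-(f p ^ 2)⁻¹ * d₁) (-(f p ^ 2)⁻¹ * d₂)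
      (-(f p ^ 2)⁻¹ * dA) (-(f p ^ 2)⁻¹ * dC) := by
  have h := (hasFDerivAt_inv (x := f ((0 : E × P) +ᵥ p)) (by rwa [zero_vadd])).comp 0 hf
  refine h.congr_fderiv ?_
  ext u <;> simp <;> ring

theorem phi : T.HasJet a (fun p' : S × P => T.phi p'.2) p 0 0 1 0 := by
  have h : HasFDerivAt (fun u : E × P => T.Omega u.2 T.c + T.Omega p.2 T.c)
      (T.coframe a 0 0 1 0) 0 := by
    have := (((T.Omega.flip T.c).comp (ContinuousLinearMap.snd ℝ E P)).hasFDerivAt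
      (x := 0)).add_const (T.Omega p.2 T.c)
    refine this.congr_fderiv ?_
    ext u <;> simp
  refine h.congr_of_eventuallyEq (Filter.Eventually.of_forall fun u => ?_)
  simp [TwoPlaneSystem.phi]

theorem psi : T.HasJet a (fun p' : S × P => T.Omega a p'.2) p 0 0 0 1 := by
  have h : HasFDerivAt (fun u : E × P => T.Omega a u.2 + T.Omega a p.2)
      (T.coframe a 0 0 0 1) 0 := by
    have := (((T.Omega a).comp (ContinuousLinearMap.snd ℝ E P)).hasFDerivAt
      (x := 0)).add_const (T.Omega a p.2)
    refine this.congr_fderiv ?_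
    ext u <;> simp
  refine h.congr_of_eventuallyEq (Filter.Eventually.of_forall fun u => ?_)
  simp

theorem pow (hf : T.HasJet a f p d₁ d₂ dA dC) (n : ℕ) :
    T.HasJet a (fun p' => f p' ^ n) p (n * f p ^ (n - 1) * d₁) (n * f p ^ (n - 1) * d₂)
      (n * f p ^ (n - 1) * dA) (n * f p ^ (n - 1) * dC) := by
  refine (HasFDerivAt.pow hf n).congr_fderiv ?_
  ext u <;> simp <;> ring

end HasJet

end TwoPlaneSystem

/-! ### Smooth functions on the base -/

section Affine

theorem affDeriv_congr {G W Q : Type*} [NormedAddCommGroup G]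
    [NormedSpace ℝ G] [NormedAddCommGroup W] [NormedSpace ℝ W] [AddTorsor W Q]
    {f g : Q → G} {x : Q} (h : ∀ᶠ u : W in nhds 0, f (u +ᵥ x) = g (u +ᵥ x)) :
    (affDeriv f x : W →L[ℝ] G) = affDeriv g x :=
  Filter.EventuallyEq.fderiv_eq h

theorem two_le_infty : (2 : WithTop ℕ∞) ≤ ∞ := WithTop.coe_le_coe.2 le_top

theorem eventually_vadd_mem {E S : Type*} [NormedAddCommGroup E] [MetricSpace S]
    [NormedAddTorsor E S] {U : Set S} (hU : IsOpen U) {y : S} (hy : y ∈ U) :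
    ∀ᶠ u : E in nhds 0, u +ᵥ y ∈ U := by
  have hc : Continuous fun u : E => u +ᵥ y := by fun_prop
  exact hc.continuousAt.preimage_mem_nhds (hU.mem_nhds (by simpa using hy))

variable {E S : Type*} [NormedAddCommGroup E] [NormedSpace ℝ E] [MetricSpace S]
  [NormedAddTorsor E S] {G G' : Type*} [NormedAddCommGroup G] [NormedSpace ℝ G]
  [NormedAddCommGroup G'] [NormedSpace ℝ G']

/-- Recentring at `u +ᵥ y` is a translation in the chart centred at `y`. Iterated affine derivatives
thereby become iterated Fréchet derivatives of a single function on the vector space `E`. -/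
theorem affDeriv_eq_fderiv (f : S → G) (y : S) (u : E) :
    affDeriv f (u +ᵥ y) = fderiv ℝ (fun v : E => f (v +ᵥ y)) u := by
  have h : (fun v : E => f (v +ᵥ (u +ᵥ y))) = fun v => (fun v : E => f (v +ᵥ y)) (v + u) := by
    ext v
    rw [vadd_vadd]
  rw [affDeriv, h, fderiv_comp_add_right (f := fun v : E => f (v +ᵥ y)), zero_add]

theorem AffSmoothOn.differentiableAt {f : S → G} {U : Set S}
    (hf : AffSmoothOn (W := E) f U) {y : S} (hy : y ∈ U) :
    DifferentiableAt ℝ (fun u : E => f (u +ᵥ y)) 0 :=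
  (hf y hy).differentiableAt (by simp)

theorem AffSmoothOn.affDeriv_apply {f : S → G} {U : Set S} (hf : AffSmoothOn (W := E) f U)
    (w : E) : AffSmoothOn (W := E) (fun y => affDeriv f y w) U := by
  intro y hy
  simp only [affDeriv_eq_fderiv]
  exact ((hf y hy).fderiv_right (m := ∞) (by simp)).clm_apply contDiffAt_const

/-- Both iterated derivatives are values of one second Fréchet derivative in the chart centred at
`y`, which is symmetric. -/
theorem AffSmoothOn.affDeriv_comm {f : S → G} {U : Set S} (hf : AffSmoothOn (W := E) f U)
    {y : S} (hy : y ∈ U) (v w : E) :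
    affDeriv (fun y' => affDeriv f y' v) y w = affDeriv (fun y' => affDeriv f y' w) y v := by
  have key : ∀ v w : E, affDeriv (fun y' => affDeriv f y' v) y w =
      fderiv ℝ (fderiv ℝ fun u : E => f (u +ᵥ y)) 0 w v := by
    intro v w
    have hd : DifferentiableAt ℝ (fderiv ℝ fun u : E => f (u +ᵥ y)) 0 :=
      ((hf y hy).fderiv_right (m := 1) (by rw [one_add_one_eq_two]; exact two_le_infty)).differentiableAt (by simp)
    rw [affDeriv]
    simp only [affDeriv_eq_fderiv]
    rw [fderiv_clm_apply hd (differentiableAt_const v)]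
    simp
  rw [key, key]
  exact ((hf y hy).isSymmSndFDerivAt (by simpa using two_le_infty)).eq w v

theorem AffSmoothOn.clm_comp {f : S → G} {U : Set S} (hf : AffSmoothOn (W := E) f U)
    (l : G →L[ℝ] G') : AffSmoothOn (W := E) (fun y => l (f y)) U :=
  fun y hy => l.contDiff.contDiffAt.comp 0 (hf y hy)

theorem AffSmoothOn.affDeriv_clm {f : S → G} {U : Set S} (hf : AffSmoothOn (W := E) f U)
    (l : G →L[ℝ] G') {y : S} (hy : y ∈ U) (w : E) :
    affDeriv (fun y' => l (f y')) y w = l (affDeriv f y w) := by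
  have h := (l.hasFDerivAt.comp (0 : E) (hf.differentiableAt hy).hasFDerivAt).fderiv
  exact DFunLike.congr_fun h w

end Affine

namespace TwoPlaneSystem

variable {E P S : Type*} [NormedAddCommGroup E] [NormedSpace ℝ E]
  [NormedAddCommGroup P] [NormedSpace ℝ P] [MetricSpace S] [NormedAddTorsor E S]
  {T : TwoPlaneSystem E P} {a : P} {U : Set S}

theorem HasJet.of_base {k : S → ℝ} (hk : AffSmoothOn (W := E) k U) {p : S × P} (hp : p.1 ∈ U) :
    T.HasJet a (fun p' => k p'.1) p (T.pd1 k p.1) (T.pd2 k p.1) 0 0 := by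
  have h := HasFDerivAt.comp (0 : E × P)
    (show HasFDerivAt (fun u : E => k (u +ᵥ p.1)) (affDeriv k p.1) (0 : E × P).1 from
      (hk.differentiableAt hp).hasFDerivAt)
    (ContinuousLinearMap.fst ℝ E P).hasFDerivAt
  refine HasFDerivAt.congr_fderiv h ?_
  ext u
  · simp only [pd1, pd2, ContinuousLinearMap.comp_apply, coframe_apply]
    conv_lhs => rw [T.eq_d1_d2 u]
    simp
    ring
  · simp

theorem eventually_vadd_mem_prod (hU : IsOpen U) {p : S × P} (hp : p ∈ U ×ˢ T.halfPlane) :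
    ∀ᶠ u : E × P in nhds 0, u +ᵥ p ∈ U ×ˢ T.halfPlane := by
  have hc : Continuous fun u : E × P => u +ᵥ p :=
    (by fun_prop : Continuous fun u : E × P => ((u.1 +ᵥ p.1, u.2 + p.2) : S × P))
  exact hc.continuousAt.preimage_mem_nhds
    ((hU.prod T.isOpen_halfPlane).mem_nhds (by simpa using hp))

/-- Explicit formulas for `F` and `γ` are available on `U × Π₊` only; its openness is what allows
them to be differentiated. -/
theorem HasJet.congr (hU : IsOpen U) {f g : S × P → ℝ} {p : S × P}
    (hp : p ∈ U ×ˢ T.halfPlane) {d₁ d₂ dA dC : ℝ} (hg : T.HasJet a g p d₁ d₂ dA dC)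
    (h : ∀ p' ∈ U ×ˢ T.halfPlane, f p' = g p') : T.HasJet a f p d₁ d₂ dA dC :=
  HasFDerivAt.congr_of_eventuallyEq hg
    ((eventually_vadd_mem_prod hU hp).mono fun _ hu => h _ hu)

end TwoPlaneSystem

namespace TwoPlaneSystem

variable {E P S : Type*} [NormedAddCommGroup E] [NormedSpace ℝ E]
  [NormedAddCommGroup P] [NormedSpace ℝ P]

/-! ### The metric and the form `γ` in coordinates -/

theorem apply_eq_d1_d2 (T : TwoPlaneSystem E P) (l : E →L[ℝ] P) (w : E) :
    l w = T.xi w • l T.d1 + T.tau w • l T.d2 := by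
  conv_lhs => rw [T.eq_d1_d2 w]
  simp

theorem h_eq_coord (T : TwoPlaneSystem E P) {a : P} (ha : T.Omega a T.c = 1) (x v : P) (w : E) :
    T.h x v w = T.xi w * (T.phi x * T.Omega a v - T.Omega a x * T.Omega v T.c)
      - T.tau w * T.Omega v T.c := by
  simp only [h, Y, map_add, map_smul, add_apply, smul_apply, smul_eq_mul]
  rw [T.Omega_eq_coord ha x v, T.Omega_swap T.c v, phi]
  ring

theorem metric_eq_coord (T : TwoPlaneSystem E P) {a : P} (ha : T.Omega a T.c = 1)
    (F : S × P → E →L[ℝ] P) (p : S × P) (z z' : E × P) :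
    T.metric F p z z' =
      T.xi z'.1 * (T.phi p.2 * (T.Omega a z.2 -
          (T.xi z.1 * T.Omega a (F p T.d1) + T.tau z.1 * T.Omega a (F p T.d2)))
        - T.Omega a p.2 * (T.Omega z.2 T.c -
          (T.xi z.1 * T.Omega (F p T.d1) T.c + T.tau z.1 * T.Omega (F p T.d2) T.c)))
      - T.tau z'.1 * (T.Omega z.2 T.c -
          (T.xi z.1 * T.Omega (F p T.d1) T.c + T.tau z.1 * T.Omega (F p T.d2) T.c))
      + (T.xi z.1 * (T.phi p.2 * (T.Omega a z'.2 -
          (T.xi z'.1 * T.Omega a (F p T.d1) + T.tau z'.1 * T.Omega a (F p T.d2)))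
        - T.Omega a p.2 * (T.Omega z'.2 T.c -
          (T.xi z'.1 * T.Omega (F p T.d1) T.c + T.tau z'.1 * T.Omega (F p T.d2) T.c)))
      - T.tau z.1 * (T.Omega z'.2 T.c -
          (T.xi z'.1 * T.Omega (F p T.d1) T.c + T.tau z'.1 * T.Omega (F p T.d2) T.c))) := by
  rw [metric, T.h_eq_coord ha, T.h_eq_coord ha, T.apply_eq_d1_d2 (F p) z.1,
    T.apply_eq_d1_d2 (F p) z'.1]
  simp only [map_add, map_sub, map_smul, add_apply, sub_apply, smul_apply, smul_eq_mul]

theorem metric_lift_right (T : TwoPlaneSystem E P) (F : S × P → E →L[ℝ] P) (p : S × P)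
    (z : E × P) (w : E) : T.metric F p z (lift F p w) = T.h p.2 (z.2 - F p z.1) w := by
  simp [metric, lift, h]

/-- This pairing is the only one that enters `γ`. It can be read off the formula for `sharp` for an
arbitrary function `l`, so the linearity of the Koszul expression is not needed. -/
theorem metric_sharp_lift_d2 (T : TwoPlaneSystem E P) (F : S × P → E →L[ℝ] P) (p : S × P)
    (hp : T.phi p.2 ≠ 0) (l : E × P → ℝ) (z : E × P) :
    T.metric F p (z + T.sharp F p l) (lift F p T.d2) =
      T.metric F p z (lift F p T.d2) + l (lift F p T.d2) := by
  have h1 : T.Omega T.c p.2 = -T.phi p.2 := T.Omega_swap _ _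
  rw [metric_lift_right, metric_lift_right]
  simp only [h, Y, sharp, lift, Prod.fst_add, Prod.snd_add, map_add, map_smul, map_sub,
    T.d2_spec.1, T.d2_spec.2, zero_smul, one_smul, zero_add, smul_eq_mul, T.Omega_self, h1,
    add_zero]
  field_simp
  ring

variable [AddTorsor E S]

section Gamma

variable {T : TwoPlaneSystem E P} {a : P} {F : S × P → E →L[ℝ] P} {p : S × P}
  {A₁₁ A₁₂ A₁A A₁C C₁₁ C₁₂ C₁A C₁C A₂₁ A₂₂ A₂A A₂C C₂₁ C₂₂ C₂A C₂C : ℝ}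

theorem hasFDerivAt_of_coord (ha : T.Omega a T.c = 1) {f : S × P → P} {d₁ d₂ dA dC e₁ e₂ eA eC : ℝ}
    (hA : T.HasJet a (fun p' => T.Omega (f p') T.c) p d₁ d₂ dA dC)
    (hC : T.HasJet a (fun p' => T.Omega a (f p')) p e₁ e₂ eA eC) :
    HasFDerivAt (fun u : E × P => f (u +ᵥ p))
      ((T.coframe a d₁ d₂ dA dC).smulRight a + (T.coframe a e₁ e₂ eA eC).smulRight T.c) 0 := by
  have h := (HasFDerivAt.smul_const hA a).add (HasFDerivAt.smul_const hC T.c)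
  exact h.congr_of_eventuallyEq
    (Filter.Eventually.of_forall fun u => T.eq_smul_add_smul ha (f (u +ᵥ p)))

theorem affDeriv_lift_d1 (ha : T.Omega a T.c = 1)
    (hA₁ : T.HasJet a (fun p' => T.Omega (F p' T.d1) T.c) p A₁₁ A₁₂ A₁A A₁C)
    (hC₁ : T.HasJet a (fun p' => T.Omega a (F p' T.d1)) p C₁₁ C₁₂ C₁A C₁C) (u : E × P) :
    affDeriv (fun p' : S × P => lift F p' T.d1) p u =
      (0, T.coframe a A₁₁ A₁₂ A₁A A₁C u • a + T.coframe a C₁₁ C₁₂ C₁A C₁C u • T.c) := by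
  have h := (hasFDerivAt_const T.d1 (0 : E × P)).prodMk (hasFDerivAt_of_coord ha hA₁ hC₁)
  exact DFunLike.congr_fun h.fderiv u

/-- For constant `z, z'` the metric is a sum of two terms of this shape, exchanged by swapping `z`
and `z'`. In the first, `x, t` are the values of `ξ, τ` on `z'`, `m, n` those on `z`, and `α, κ` the
fibre coordinates of `z`. -/
theorem hasJet_pairing {f₁ g₁ f₂ g₂ : S × P → ℝ}
    (hA₁ : T.HasJet a f₁ p A₁₁ A₁₂ A₁A A₁C) (hC₁ : T.HasJet a g₁ p C₁₁ C₁₂ C₁A C₁C)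
    (hA₂ : T.HasJet a f₂ p A₂₁ A₂₂ A₂A A₂C) (hC₂ : T.HasJet a g₂ p C₂₁ C₂₂ C₂A C₂C)
    {x t α κ m n : ℝ} :
    T.HasJet a (fun p' => x * (T.phi p'.2 * (κ - (m * g₁ p' + n * g₂ p'))
        - T.Omega a p'.2 * (α - (m * f₁ p' + n * f₂ p'))) - t * (α - (m * f₁ p' + n * f₂ p'))) p
      (x * (T.Omega a p.2 * (m * A₁₁ + n * A₂₁) - T.phi p.2 * (m * C₁₁ + n * C₂₁)) + t * (m * A₁₁ + n * A₂₁))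
      (x * (T.Omega a p.2 * (m * A₁₂ + n * A₂₂) - T.phi p.2 * (m * C₁₂ + n * C₂₂)) + t * (m * A₁₂ + n * A₂₂))
      (x * (T.Omega a p.2 * (m * A₁A + n * A₂A) - T.phi p.2 * (m * C₁A + n * C₂A)
        + (κ - (m * g₁ p + n * g₂ p))) + t * (m * A₁A + n * A₂A))
      (x * (T.Omega a p.2 * (m * A₁C + n * A₂C) - T.phi p.2 * (m * C₁C + n * C₂C)
        - (α - (m * f₁ p + n * f₂ p))) + t * (m * A₁C + n * A₂C)) := by
  have hα := (HasJet.const α).sub (((HasJet.const m).mul hA₁).add ((HasJet.const n).mul hA₂))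
  have hκ := (HasJet.const κ).sub (((HasJet.const m).mul hC₁).add ((HasJet.const n).mul hC₂))
  exact (((HasJet.const x).mul ((HasJet.phi.mul hκ).sub (HasJet.psi.mul hα))).sub
    ((HasJet.const t).mul hα)).of_eq (by ring) (by ring) (by ring) (by ring)

/-- The value of `γ`, in terms of the partial derivatives of the components of `F`. -/
theorem gamma_eq (ha : T.Omega a T.c = 1) (hp : T.phi p.2 ≠ 0)
    (hA₁ : T.HasJet a (fun p' => T.Omega (F p' T.d1) T.c) p A₁₁ A₁₂ A₁A A₁C)
    (hC₁ : T.HasJet a (fun p' => T.Omega a (F p' T.d1)) p C₁₁ C₁₂ C₁A C₁C)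
    (hA₂ : T.HasJet a (fun p' => T.Omega (F p' T.d2) T.c) p A₂₁ A₂₂ A₂A A₂C)
    (hC₂ : T.HasJet a (fun p' => T.Omega a (F p' T.d2)) p C₂₁ C₂₂ C₂A C₂C) {A₁ C₁ A₂ C₂ : ℝ}
    (eA₁ : T.Omega (F p T.d1) T.c = A₁) (eC₁ : T.Omega a (F p T.d1) = C₁)
    (eA₂ : T.Omega (F p T.d2) T.c = A₂) (eC₂ : T.Omega a (F p T.d2) = C₂) (u : E × P) :
    T.gamma F p u =
      T.xi u.1 * (T.phi p.2 / 2 *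
        (T.phi p.2 * (C₂₁ + A₁ * C₂A + C₁ * C₂C - (C₁₂ + A₂ * C₁A + C₂ * C₁C))
          - T.Omega a p.2 * (A₂₁ + A₁ * A₂A + C₁ * A₂C - (A₁₂ + A₂ * A₁A + C₂ * A₁C))))
      + T.tau u.1 *
        (-(T.phi p.2 / 2) * (A₂₁ + A₁ * A₂A + C₁ * A₂C - (A₁₂ + A₂ * A₁A + C₂ * A₁C)))
      + (T.Omega u.2 T.c - (T.xi u.1 * A₁ + T.tau u.1 * A₂)) *
        (T.phi p.2 / 4 * (A₁A + T.phi p.2 * C₂A - T.Omega a p.2 * A₂A - C₂))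
      + (T.Omega a u.2 - (T.xi u.1 * C₁ + T.tau u.1 * C₂)) *
        (T.phi p.2 / 4 * (A₁C + T.phi p.2 * C₂C - T.Omega a p.2 * A₂C + A₂)) := by
  have hm := fun z z' : E × P => (hasJet_pairing (x := T.xi z'.1) (t := T.tau z'.1)
    (α := T.Omega z.2 T.c) (κ := T.Omega a z.2) (m := T.xi z.1) (n := T.tau z.1)
    hA₁ hC₁ hA₂ hC₂).add (hasJet_pairing (x := T.xi z.1) (t := T.tau z.1)
    (α := T.Omega z'.2 T.c) (κ := T.Omega a z'.2) (m := T.xi z'.1) (n := T.tau z'.1)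
    hA₁ hC₁ hA₂ hC₂)
  simp only [← T.metric_eq_coord ha] at hm
  have hca : T.Omega T.c a = -1 := by rw [T.Omega_swap, ha]
  have hac : T.Omega T.c p.2 = -T.phi p.2 := T.Omega_swap _ _
  -- The derivative of the section `w₁` itself is added to the Koszul expression for vectors frozen
  -- at `p`. The horizontal terms then combine into the components of the bracket `[w₁, w₂]`.
  rw [gamma, nabla, christoffel, T.metric_sharp_lift_d2 F p hp, T.metric_lift_right,
    affDeriv_lift_d1 ha hA₁ hC₁, T.h_eq_coord ha]
  simp only [HasJet.affDeriv_apply (hm _ _), coframe_apply, lift, T.d1_spec.1, T.d1_spec.2,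
    T.d2_spec.1, T.d2_spec.2, map_add, map_smul, map_zero, add_apply,
    smul_apply, smul_eq_mul, T.Omega_self, ha, eA₁, eC₁, eA₂, eC₂, sub_zero]
  ring

end Gamma

end TwoPlaneSystem

/-! ### Condition (d) at a point as five scalar equations -/

namespace TwoPlaneSystem

variable {E P S : Type*} [NormedAddCommGroup E] [NormedSpace ℝ E]
  [NormedAddCommGroup P] [NormedSpace ℝ P] [MetricSpace S] [NormedAddTorsor E S]
  {T : TwoPlaneSystem E P} {a : P} {U : Set S} {F : S × P → E →L[ℝ] P} {p : S × P}
  {A₁ C₁ A₂ C₂ g₁ g₂ gA gC : S × P → ℝ}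
  {A₁₁ A₁₂ A₁A A₁C C₁₁ C₁₂ C₁A C₁C A₂₁ A₂₂ A₂A A₂C C₂₁ C₂₂ C₂A C₂C : ℝ}
  {g₁₁ g₁₂ g₁A g₁C g₂₁ g₂₂ g₂A g₂C gA₁ gA₂ gAA gAC gC₁ gC₂ gCA gCC : ℝ}

/-- Condition (d) at a single point, in terms of the components `g₁, g₂` of `γ` on the sections
of `H + F` arising from `∂₁, ∂₂`, and `gA, gC` on the vertical vectors `a, c`. -/
theorem condD_at_iff (ha : T.Omega a T.c = 1) (hU : IsOpen U) (hp : p ∈ U ×ˢ T.halfPlane)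
    (hF : ∀ p ∈ U ×ˢ T.halfPlane, T.Omega (F p T.d1) T.c = A₁ p ∧ T.Omega a (F p T.d1) = C₁ p ∧
      T.Omega (F p T.d2) T.c = A₂ p ∧ T.Omega a (F p T.d2) = C₂ p)
    (hγ : ∀ p ∈ U ×ˢ T.halfPlane, ∀ u : E × P, T.gamma F p u =
      T.xi u.1 * g₁ p + T.tau u.1 * g₂ p
      + (T.Omega u.2 T.c - (T.xi u.1 * A₁ p + T.tau u.1 * A₂ p)) * gA p
      + (T.Omega a u.2 - (T.xi u.1 * C₁ p + T.tau u.1 * C₂ p)) * gC p)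
    (hA₁ : T.HasJet a A₁ p A₁₁ A₁₂ A₁A A₁C) (hC₁ : T.HasJet a C₁ p C₁₁ C₁₂ C₁A C₁C)
    (hA₂ : T.HasJet a A₂ p A₂₁ A₂₂ A₂A A₂C) (hC₂ : T.HasJet a C₂ p C₂₁ C₂₂ C₂A C₂C)
    (hg₁ : T.HasJet a g₁ p g₁₁ g₁₂ g₁A g₁C) (hg₂ : T.HasJet a g₂ p g₂₁ g₂₂ g₂A g₂C)
    (hgA : T.HasJet a gA p gA₁ gA₂ gAA gAC) (hgC : T.HasJet a gC p gC₁ gC₂ gCA gCC)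
    {x y α₁ α₂ : ℝ} (hx : T.phi p.2 = x) (hy : T.Omega a p.2 = y)
    (hα₁ : α₁ = -4 * (x ^ 2)⁻¹ * (x * gA p + y * gC p)) (hα₂ : α₂ = -4 * (x ^ 2)⁻¹ * gC p) :
    (∀ (z : E × P) (w : E), extDerivOne (T.gamma F) p z (lift F p w)
        + 2 * wedgeOne (T.alpha F p) (T.gamma F p) z (lift F p w)
      = T.metric F p z (lift F p w) / 2) ↔
    g₁A - (gA₁ + A₁ p * gAA + C₁ p * gAC) - (A₁A * gA p + C₁A * gC p)
      + 2 * (-x⁻¹ * g₁ p - α₁ * gA p) + y / 2 = 0 ∧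
    g₁C - (gC₁ + A₁ p * gCA + C₁ p * gCC) - (A₁C * gA p + C₁C * gC p)
      - 2 * α₁ * gC p - x / 2 = 0 ∧
    g₂A - (gA₂ + A₂ p * gAA + C₂ p * gAC) - (A₂A * gA p + C₂A * gC p)
      + 2 * (-x⁻¹ * g₂ p - α₂ * gA p) + 1 / 2 = 0 ∧
    g₂C - (gC₂ + A₂ p * gCA + C₂ p * gCC) - (A₂C * gA p + C₂C * gC p) - 2 * α₂ * gC p = 0 ∧
    g₂₁ + A₁ p * g₂A + C₁ p * g₂C - (g₁₂ + A₂ p * g₁A + C₂ p * g₁C)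
      - ((A₂₁ + A₁ p * A₂A + C₁ p * A₂C - (A₁₂ + A₂ p * A₁A + C₂ p * A₁C)) * gA p
        + (C₂₁ + A₁ p * C₂A + C₁ p * C₂C - (C₁₂ + A₂ p * C₁A + C₂ p * C₁C)) * gC p)
      + 2 * (α₁ * g₂ p - α₂ * g₁ p) = 0 := by
  have hjet := fun u : E × P => HasJet.congr hU hp
    (((((HasJet.const (T.xi u.1)).mul hg₁).add ((HasJet.const (T.tau u.1)).mul hg₂)).add
      (((HasJet.const (T.Omega u.2 T.c)).sub (((HasJet.const (T.xi u.1)).mul hA₁).add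
        ((HasJet.const (T.tau u.1)).mul hA₂))).mul hgA)).add
      (((HasJet.const (T.Omega a u.2)).sub (((HasJet.const (T.xi u.1)).mul hC₁).add
        ((HasJet.const (T.tau u.1)).mul hC₂))).mul hgC))
    fun p' hp' => hγ p' hp' u
  obtain ⟨eA₁, eC₁, eA₂, eC₂⟩ := hF p hp
  have hAF : ∀ w, T.Omega (F p w) T.c = T.xi w * A₁ p + T.tau w * A₂ p := by
    intro w
    rw [T.apply_eq_d1_d2 (F p) w]
    simp [eA₁, eA₂]
  have hCF : ∀ w, T.Omega a (F p w) = T.xi w * C₁ p + T.tau w * C₂ p := by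
    intro w
    rw [T.apply_eq_d1_d2 (F p) w]
    simp [eC₁, eC₂]
  -- Here `α₁, α₂` are the values of `α` on `w₁, w₂`: they equal `2γ(ζ∂ᵢ)` with `ζ∂ᵢ = -2φ⁻²
  -- Y_{∂ᵢ}`, where `Y_{∂₁} = X` and `Y_{∂₂} = c`.
  have hα : ∀ z : E × P, T.alpha F p z =
      -x⁻¹ * (T.Omega z.2 T.c - (T.xi z.1 * A₁ p + T.tau z.1 * A₂ p))
        + T.xi z.1 * α₁ + T.tau z.1 * α₂ := by
    intro z
    rw [alpha, hγ p hp]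
    simp only [zetaVec, Y, map_add, map_sub, map_smul, map_zero, add_apply, sub_apply, smul_apply,
      smul_eq_mul, T.Omega_self, hAF, ha, hy, hα₁, hα₂, hx,
      show T.Omega p.2 T.c = x from hx]
    ring
  -- Expansion in the coframe adapted to `V` and `H + F`. Because the second argument lies in `H +
  -- F`, only the four mixed products and `ξ ∧ τ` occur.
  have key : ∀ (z : E × P) (w : E), extDerivOne (T.gamma F) p z (lift F p w)
        + 2 * wedgeOne (T.alpha F p) (T.gamma F p) z (lift F p w)
      - T.metric F p z (lift F p w) / 2 =
    (T.Omega z.2 T.c - (T.xi z.1 * A₁ p + T.tau z.1 * A₂ p)) * T.xi w *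
      (g₁A - (gA₁ + A₁ p * gAA + C₁ p * gAC) - (A₁A * gA p + C₁A * gC p)
      + 2 * (-x⁻¹ * g₁ p - α₁ * gA p) + y / 2) +
    (T.Omega a z.2 - (T.xi z.1 * C₁ p + T.tau z.1 * C₂ p)) * T.xi w *
      (g₁C - (gC₁ + A₁ p * gCA + C₁ p * gCC) - (A₁C * gA p + C₁C * gC p)
      - 2 * α₁ * gC p - x / 2) +
    (T.Omega z.2 T.c - (T.xi z.1 * A₁ p + T.tau z.1 * A₂ p)) * T.tau w *
      (g₂A - (gA₂ + A₂ p * gAA + C₂ p * gAC) - (A₂A * gA p + C₂A * gC p)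
      + 2 * (-x⁻¹ * g₂ p - α₂ * gA p) + 1 / 2) +
    (T.Omega a z.2 - (T.xi z.1 * C₁ p + T.tau z.1 * C₂ p)) * T.tau w *
      (g₂C - (gC₂ + A₂ p * gCA + C₂ p * gCC) - (A₂C * gA p + C₂C * gC p) - 2 * α₂ * gC p) +
    (T.xi z.1 * T.tau w - T.tau z.1 * T.xi w) *
      (g₂₁ + A₁ p * g₂A + C₁ p * g₂C - (g₁₂ + A₂ p * g₁A + C₂ p * g₁C)
      - ((A₂₁ + A₁ p * A₂A + C₁ p * A₂C - (A₁₂ + A₂ p * A₁A + C₂ p * A₁C)) * gA p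
        + (C₂₁ + A₁ p * C₂A + C₁ p * C₂C - (C₁₂ + A₂ p * C₁A + C₂ p * C₁C)) * gC p)
      + 2 * (α₁ * g₂ p - α₂ * g₁ p)) := by
    intro z w
    rw [T.metric_lift_right, T.h_eq_coord ha, extDerivOne, (hjet (lift F p w)).affDeriv_apply,
      (hjet z).affDeriv_apply, wedgeOne, hα, hα, hγ p hp, hγ p hp]
    simp only [lift, map_sub, sub_apply, hAF, hCF, hx, hy]
    ring
  constructor
  · intro h
    have h' := fun z w => (key z w).symm.trans (sub_eq_zero.2 (h z w))
    -- Evaluation on pairs of vectors of the dual frame isolates each coefficient.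
    refine ⟨?_, ?_, ?_, ?_, ?_⟩
    · simpa [ha, T.d1_spec, T.Omega_self] using h' (0, a) T.d1
    · simpa [ha, T.d1_spec, T.Omega_self] using h' (0, T.c) T.d1
    · simpa [ha, T.d2_spec, T.Omega_self] using h' (0, a) T.d2
    · simpa [ha, T.d2_spec, T.Omega_self] using h' (0, T.c) T.d2
    · simpa [lift, hAF, hCF, T.d1_spec, T.d2_spec] using h' (lift F p T.d1) T.d2
  · rintro ⟨h₁, h₂, h₃, h₄, h₅⟩ z w
    rw [← sub_eq_zero, key, h₁, h₂, h₃, h₄, h₅]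
    ring

end TwoPlaneSystem

namespace TwoPlaneSystem

/-! ### Components of the explicit sections

The values of `(q, λ, μ, r)` at a point of `Σ` are encoded as `κ : Fin 9 → ℝ`, listing
`Ω(q, c), Ω(a, q), λ(a, a), λ(a, c), λ(c, c), μ(a, a), μ(a, c), μ(c, c), r`, while `s, t` stand
for the coordinates `φ = Ω(x, c)` and `Ω(a, x)` in `Π₊`.  The suffixes `A` and `C` denote the
partial derivatives with respect to `s` and `t`. -/

/-- The component `Ω(F ∂₁, c)` of the explicit section. -/
def compA₁ (κ : Fin 9 → ℝ) (s t : ℝ) : ℝ :=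
  3 / 2 * κ 0 - κ 3 * s / 2 - κ 4 * t / 2 - κ 5 * s ^ 2 / 2 - κ 6 * s * t - κ 7 * t ^ 2 / 2 - 2 * κ 8 * s ^ 2

/-- A partial derivative of `compA₁`. -/
def compA₁A (κ : Fin 9 → ℝ) (s t : ℝ) : ℝ :=
  -κ 3 / 2 - κ 5 * s - κ 6 * t - 4 * κ 8 * s

/-- A partial derivative of `compA₁`. -/
def compA₁C (κ : Fin 9 → ℝ) (s t : ℝ) : ℝ :=
  -κ 4 / 2 - κ 6 * s - κ 7 * t

/-- The component `Ω(a, F ∂₁)` of the explicit section. -/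
def compC₁ (κ : Fin 9 → ℝ) (s t : ℝ) : ℝ :=
  2 * κ 1 + κ 2 * s + 3 / 2 * κ 3 * t - κ 5 * s * t / 2 - κ 6 * t ^ 2 - 2 * κ 8 * s * t + (κ 4 * t ^ 2 - κ 7 * t ^ 3 - κ 0 * t) / 2 * s⁻¹

/-- A partial derivative of `compC₁`. -/
def compC₁A (κ : Fin 9 → ℝ) (s t : ℝ) : ℝ :=
  κ 2 - κ 5 * t / 2 - 2 * κ 8 * t - (κ 4 * t ^ 2 - κ 7 * t ^ 3 - κ 0 * t) / 2 * (s⁻¹) ^ 2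

/-- A partial derivative of `compC₁`. -/
def compC₁C (κ : Fin 9 → ℝ) (s t : ℝ) : ℝ :=
  3 / 2 * κ 3 - κ 5 * s / 2 - 2 * κ 6 * t - 2 * κ 8 * s + (2 * κ 4 * t - 3 * κ 7 * t ^ 2 - κ 0) / 2 * s⁻¹

/-- The component `Ω(F ∂₂, c)` of the explicit section. -/
def compA₂ (K : ℝ) (κ : Fin 9 → ℝ) (s t : ℝ) : ℝ :=
  K * s ^ 2 / 2 + κ 4 - 2 * κ 6 * s - 2 * κ 7 * t

/-- A partial derivative of `compA₂`. -/
def compA₂A (K : ℝ) (κ : Fin 9 → ℝ) (s _ : ℝ) : ℝ :=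
  K * s - 2 * κ 6

/-- A partial derivative of `compA₂`. -/
def compA₂C (_ : ℝ) (κ : Fin 9 → ℝ) (_ _ : ℝ) : ℝ :=
  -2 * κ 7

/-- The component `Ω(a, F ∂₂)` of the explicit section. -/
def compC₂ (K : ℝ) (κ : Fin 9 → ℝ) (s t : ℝ) : ℝ :=
  K * s * t / 2 - κ 3 / 2 + 3 / 2 * κ 5 * s + κ 6 * t - 2 * κ 8 * s + (κ 4 * t - κ 7 * t ^ 2 - κ 0) / 2 * s⁻¹

/-- A partial derivative of `compC₂`. -/
def compC₂A (K : ℝ) (κ : Fin 9 → ℝ) (s t : ℝ) : ℝ :=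
  K * t / 2 + 3 / 2 * κ 5 - 2 * κ 8 - (κ 4 * t - κ 7 * t ^ 2 - κ 0) / 2 * (s⁻¹) ^ 2

/-- A partial derivative of `compC₂`. -/
def compC₂C (K : ℝ) (κ : Fin 9 → ℝ) (s t : ℝ) : ℝ :=
  K * s / 2 + κ 6 + (κ 4 - 2 * κ 7 * t) / 2 * s⁻¹

variable {E P S : Type*} [NormedAddCommGroup E] [NormedSpace ℝ E]
  [NormedAddCommGroup P] [NormedSpace ℝ P] [MetricSpace S] [NormedAddTorsor E S]
  {T : TwoPlaneSystem E P} {a : P} {U : Set S} {p : S × P} {k : S → Fin 9 → ℝ}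

theorem HasJet.coeff (hk : AffSmoothOn (W := E) k U) (hp : p.1 ∈ U) (i : Fin 9) :
    T.HasJet a (fun p' => k p'.1 i) p (T.pd1 k p.1 i) (T.pd2 k p.1 i) 0 0 := by
  have h := HasJet.of_base (T := T) (a := a)
    (hk.clm_comp (ContinuousLinearMap.proj (R := ℝ) (φ := fun _ => ℝ) i)) hp
  have e := fun w => hk.affDeriv_clm (ContinuousLinearMap.proj (R := ℝ) (φ := fun _ => ℝ) i) hp w
  exact h.of_eq (e _) (e _) rfl rfl

/-- The component is linear in `κ`, so its derivatives along `Σ` are the same expression evaluated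
at the derivatives of `κ`. -/
theorem hasJet_compA₁ (hk : AffSmoothOn (W := E) k U) (hp : p ∈ U ×ˢ T.halfPlane) :
    T.HasJet a (fun p' => compA₁ (k p'.1) (T.phi p'.2) (T.Omega a p'.2)) p
      (compA₁ (T.pd1 k p.1) (T.phi p.2) (T.Omega a p.2))
      (compA₁ (T.pd2 k p.1) (T.phi p.2) (T.Omega a p.2))
      (compA₁A (k p.1) (T.phi p.2) (T.Omega a p.2))
      (compA₁C (k p.1) (T.phi p.2) (T.Omega a p.2)) := by
  have h0 : T.phi p.2 ≠ 0 := ne_of_gt hp.2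
  have hi := (HasJet.phi (T := T) (a := a) (p := p)).inv h0
  have hc := HasJet.coeff (T := T) (a := a) hk hp.1
  unfold compA₁ compA₁A compA₁C
  simp only [div_eq_mul_inv]
  -- The jet is assembled along the expression tree, with its four coefficients left as
  -- metavariables, and only afterwards compared with the stated ones. Reducible transparency keeps
  -- the rules from matching through unfolding.
  apply HasJet.of_eq
  · with_reducible repeat' first
      | exact HasJet.phi
      | exact HasJet.psi
      | exact hc _
      | exact hi
      | exact HasJet.const _
      | apply HasJet.pow
      | apply HasJet.add
      | apply HasJet.sub
      | apply HasJet.mul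
  all_goals ring

theorem hasJet_compA₁A (hk : AffSmoothOn (W := E) k U) (hp : p ∈ U ×ˢ T.halfPlane) :
    T.HasJet a (fun p' => compA₁A (k p'.1) (T.phi p'.2) (T.Omega a p'.2)) p
      (compA₁A (T.pd1 k p.1) (T.phi p.2) (T.Omega a p.2))
      (compA₁A (T.pd2 k p.1) (T.phi p.2) (T.Omega a p.2))
      (-k p.1 5 - 4 * k p.1 8)
      (-k p.1 6) := by
  have h0 : T.phi p.2 ≠ 0 := ne_of_gt hp.2
  have hi := (HasJet.phi (T := T) (a := a) (p := p)).inv h0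
  have hc := HasJet.coeff (T := T) (a := a) hk hp.1
  unfold compA₁A
  simp only [div_eq_mul_inv]
  apply HasJet.of_eq
  · with_reducible repeat' first
      | exact HasJet.phi
      | exact HasJet.psi
      | exact hc _
      | exact hi
      | exact HasJet.const _
      | apply HasJet.pow
      | apply HasJet.add
      | apply HasJet.sub
      | apply HasJet.mul
      | apply HasJet.neg
  all_goals ring

theorem hasJet_compA₁C (hk : AffSmoothOn (W := E) k U) (hp : p ∈ U ×ˢ T.halfPlane) :
    T.HasJet a (fun p' => compA₁C (k p'.1) (T.phi p'.2) (T.Omega a p'.2)) p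
      (compA₁C (T.pd1 k p.1) (T.phi p.2) (T.Omega a p.2))
      (compA₁C (T.pd2 k p.1) (T.phi p.2) (T.Omega a p.2))
      (-k p.1 6)
      (-k p.1 7) := by
  have h0 : T.phi p.2 ≠ 0 := ne_of_gt hp.2
  have hi := (HasJet.phi (T := T) (a := a) (p := p)).inv h0
  have hc := HasJet.coeff (T := T) (a := a) hk hp.1
  unfold compA₁C
  simp only [div_eq_mul_inv]
  apply HasJet.of_eq
  · with_reducible repeat' first
      | exact HasJet.phi
      | exact HasJet.psi
      | exact hc _
      | exact hi
      | exact HasJet.const _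
      | apply HasJet.pow
      | apply HasJet.add
      | apply HasJet.sub
      | apply HasJet.mul
      | apply HasJet.neg
  all_goals ring

theorem hasJet_compC₁ (hk : AffSmoothOn (W := E) k U) (hp : p ∈ U ×ˢ T.halfPlane) :
    T.HasJet a (fun p' => compC₁ (k p'.1) (T.phi p'.2) (T.Omega a p'.2)) p
      (compC₁ (T.pd1 k p.1) (T.phi p.2) (T.Omega a p.2))
      (compC₁ (T.pd2 k p.1) (T.phi p.2) (T.Omega a p.2))
      (compC₁A (k p.1) (T.phi p.2) (T.Omega a p.2))
      (compC₁C (k p.1) (T.phi p.2) (T.Omega a p.2)) := by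
  have h0 : T.phi p.2 ≠ 0 := ne_of_gt hp.2
  have hi := (HasJet.phi (T := T) (a := a) (p := p)).inv h0
  have hc := HasJet.coeff (T := T) (a := a) hk hp.1
  unfold compC₁ compC₁A compC₁C
  simp only [div_eq_mul_inv]
  apply HasJet.of_eq
  · with_reducible repeat' first
      | exact HasJet.phi
      | exact HasJet.psi
      | exact hc _
      | exact hi
      | exact HasJet.const _
      | apply HasJet.pow
      | apply HasJet.add
      | apply HasJet.sub
      | apply HasJet.mul
  all_goals ring

theorem hasJet_compC₁A (hk : AffSmoothOn (W := E) k U) (hp : p ∈ U ×ˢ T.halfPlane) :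
    T.HasJet a (fun p' => compC₁A (k p'.1) (T.phi p'.2) (T.Omega a p'.2)) p
      (compC₁A (T.pd1 k p.1) (T.phi p.2) (T.Omega a p.2))
      (compC₁A (T.pd2 k p.1) (T.phi p.2) (T.Omega a p.2))
      ((k p.1 4 * T.Omega a p.2 ^ 2 - k p.1 7 * T.Omega a p.2 ^ 3 - k p.1 0 * T.Omega a p.2) * ((T.phi p.2)⁻¹) ^ 3)
      (-k p.1 5 / 2 - 2 * k p.1 8 - (2 * k p.1 4 * T.Omega a p.2 - 3 * k p.1 7 * T.Omega a p.2 ^ 2 - k p.1 0) / 2 * ((T.phi p.2)⁻¹) ^ 2) := by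
  have h0 : T.phi p.2 ≠ 0 := ne_of_gt hp.2
  have hi := (HasJet.phi (T := T) (a := a) (p := p)).inv h0
  have hc := HasJet.coeff (T := T) (a := a) hk hp.1
  unfold compC₁A
  simp only [div_eq_mul_inv]
  apply HasJet.of_eq
  · with_reducible repeat' first
      | exact HasJet.phi
      | exact HasJet.psi
      | exact hc _
      | exact hi
      | exact HasJet.const _
      | apply HasJet.pow
      | apply HasJet.add
      | apply HasJet.sub
      | apply HasJet.mul
  all_goals ring

theorem hasJet_compC₁C (hk : AffSmoothOn (W := E) k U) (hp : p ∈ U ×ˢ T.halfPlane) :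
    T.HasJet a (fun p' => compC₁C (k p'.1) (T.phi p'.2) (T.Omega a p'.2)) p
      (compC₁C (T.pd1 k p.1) (T.phi p.2) (T.Omega a p.2))
      (compC₁C (T.pd2 k p.1) (T.phi p.2) (T.Omega a p.2))
      (-k p.1 5 / 2 - 2 * k p.1 8 - (2 * k p.1 4 * T.Omega a p.2 - 3 * k p.1 7 * T.Omega a p.2 ^ 2 - k p.1 0) / 2 * ((T.phi p.2)⁻¹) ^ 2)
      (-2 * k p.1 6 + (k p.1 4 - 3 * k p.1 7 * T.Omega a p.2) * (T.phi p.2)⁻¹) := by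
  have h0 : T.phi p.2 ≠ 0 := ne_of_gt hp.2
  have hi := (HasJet.phi (T := T) (a := a) (p := p)).inv h0
  have hc := HasJet.coeff (T := T) (a := a) hk hp.1
  unfold compC₁C
  simp only [div_eq_mul_inv]
  apply HasJet.of_eq
  · with_reducible repeat' first
      | exact HasJet.phi
      | exact HasJet.psi
      | exact hc _
      | exact hi
      | exact HasJet.const _
      | apply HasJet.pow
      | apply HasJet.add
      | apply HasJet.sub
      | apply HasJet.mul
  all_goals ring

/-- Here the dependence on `κ` is affine, with a constant term proportional to `K`. That term drops
out of the derivatives along `Σ`, hence the argument `0` in place of `K`. -/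
theorem hasJet_compA₂ {K : ℝ} (hk : AffSmoothOn (W := E) k U) (hp : p ∈ U ×ˢ T.halfPlane) :
    T.HasJet a (fun p' => compA₂ K (k p'.1) (T.phi p'.2) (T.Omega a p'.2)) p
      (compA₂ 0 (T.pd1 k p.1) (T.phi p.2) (T.Omega a p.2))
      (compA₂ 0 (T.pd2 k p.1) (T.phi p.2) (T.Omega a p.2))
      (compA₂A K (k p.1) (T.phi p.2) (T.Omega a p.2))
      (compA₂C K (k p.1) (T.phi p.2) (T.Omega a p.2)) := by
  have h0 : T.phi p.2 ≠ 0 := ne_of_gt hp.2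
  have hi := (HasJet.phi (T := T) (a := a) (p := p)).inv h0
  have hc := HasJet.coeff (T := T) (a := a) hk hp.1
  unfold compA₂ compA₂A compA₂C
  simp only [div_eq_mul_inv]
  apply HasJet.of_eq
  · with_reducible repeat' first
      | exact HasJet.phi
      | exact HasJet.psi
      | exact hc _
      | exact hi
      | exact HasJet.const _
      | apply HasJet.pow
      | apply HasJet.add
      | apply HasJet.sub
      | apply HasJet.mul
  all_goals ring

theorem hasJet_compA₂A {K : ℝ} (hk : AffSmoothOn (W := E) k U) (hp : p ∈ U ×ˢ T.halfPlane) :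
    T.HasJet a (fun p' => compA₂A K (k p'.1) (T.phi p'.2) (T.Omega a p'.2)) p
      (compA₂A 0 (T.pd1 k p.1) (T.phi p.2) (T.Omega a p.2))
      (compA₂A 0 (T.pd2 k p.1) (T.phi p.2) (T.Omega a p.2))
      (K)
      (0) := by
  have h0 : T.phi p.2 ≠ 0 := ne_of_gt hp.2
  have hi := (HasJet.phi (T := T) (a := a) (p := p)).inv h0
  have hc := HasJet.coeff (T := T) (a := a) hk hp.1
  unfold compA₂A
  apply HasJet.of_eq
  · with_reducible repeat' first
      | exact HasJet.phi
      | exact HasJet.psi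
      | exact hc _
      | exact hi
      | exact HasJet.const _
      | apply HasJet.pow
      | apply HasJet.add
      | apply HasJet.sub
      | apply HasJet.mul
  all_goals ring

theorem hasJet_compA₂C {K : ℝ} (hk : AffSmoothOn (W := E) k U) (hp : p ∈ U ×ˢ T.halfPlane) :
    T.HasJet a (fun p' => compA₂C K (k p'.1) (T.phi p'.2) (T.Omega a p'.2)) p
      (compA₂C 0 (T.pd1 k p.1) (T.phi p.2) (T.Omega a p.2))
      (compA₂C 0 (T.pd2 k p.1) (T.phi p.2) (T.Omega a p.2))
      (0)
      (0) := by
  have h0 : T.phi p.2 ≠ 0 := ne_of_gt hp.2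
  have hi := (HasJet.phi (T := T) (a := a) (p := p)).inv h0
  have hc := HasJet.coeff (T := T) (a := a) hk hp.1
  unfold compA₂C
  apply HasJet.of_eq
  · with_reducible repeat' first
      | exact HasJet.phi
      | exact HasJet.psi
      | exact hc _
      | exact hi
      | exact HasJet.const _
      | apply HasJet.pow
      | apply HasJet.add
      | apply HasJet.sub
      | apply HasJet.mul
  all_goals ring

theorem hasJet_compC₂ {K : ℝ} (hk : AffSmoothOn (W := E) k U) (hp : p ∈ U ×ˢ T.halfPlane) :
    T.HasJet a (fun p' => compC₂ K (k p'.1) (T.phi p'.2) (T.Omega a p'.2)) p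
      (compC₂ 0 (T.pd1 k p.1) (T.phi p.2) (T.Omega a p.2))
      (compC₂ 0 (T.pd2 k p.1) (T.phi p.2) (T.Omega a p.2))
      (compC₂A K (k p.1) (T.phi p.2) (T.Omega a p.2))
      (compC₂C K (k p.1) (T.phi p.2) (T.Omega a p.2)) := by
  have h0 : T.phi p.2 ≠ 0 := ne_of_gt hp.2
  have hi := (HasJet.phi (T := T) (a := a) (p := p)).inv h0
  have hc := HasJet.coeff (T := T) (a := a) hk hp.1
  unfold compC₂ compC₂A compC₂C
  simp only [div_eq_mul_inv]
  apply HasJet.of_eq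
  · with_reducible repeat' first
      | exact HasJet.phi
      | exact HasJet.psi
      | exact hc _
      | exact hi
      | exact HasJet.const _
      | apply HasJet.pow
      | apply HasJet.add
      | apply HasJet.sub
      | apply HasJet.mul
  all_goals ring

theorem hasJet_compC₂A {K : ℝ} (hk : AffSmoothOn (W := E) k U) (hp : p ∈ U ×ˢ T.halfPlane) :
    T.HasJet a (fun p' => compC₂A K (k p'.1) (T.phi p'.2) (T.Omega a p'.2)) p
      (compC₂A 0 (T.pd1 k p.1) (T.phi p.2) (T.Omega a p.2))
      (compC₂A 0 (T.pd2 k p.1) (T.phi p.2) (T.Omega a p.2))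
      ((k p.1 4 * T.Omega a p.2 - k p.1 7 * T.Omega a p.2 ^ 2 - k p.1 0) * ((T.phi p.2)⁻¹) ^ 3)
      (K / 2 - (k p.1 4 - 2 * k p.1 7 * T.Omega a p.2) / 2 * ((T.phi p.2)⁻¹) ^ 2) := by
  have h0 : T.phi p.2 ≠ 0 := ne_of_gt hp.2
  have hi := (HasJet.phi (T := T) (a := a) (p := p)).inv h0
  have hc := HasJet.coeff (T := T) (a := a) hk hp.1
  unfold compC₂A
  simp only [div_eq_mul_inv]
  apply HasJet.of_eq
  · with_reducible repeat' first
      | exact HasJet.phi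
      | exact HasJet.psi
      | exact hc _
      | exact hi
      | exact HasJet.const _
      | apply HasJet.pow
      | apply HasJet.add
      | apply HasJet.sub
      | apply HasJet.mul
  all_goals ring

theorem hasJet_compC₂C {K : ℝ} (hk : AffSmoothOn (W := E) k U) (hp : p ∈ U ×ˢ T.halfPlane) :
    T.HasJet a (fun p' => compC₂C K (k p'.1) (T.phi p'.2) (T.Omega a p'.2)) p
      (compC₂C 0 (T.pd1 k p.1) (T.phi p.2) (T.Omega a p.2))
      (compC₂C 0 (T.pd2 k p.1) (T.phi p.2) (T.Omega a p.2))
      (K / 2 - (k p.1 4 - 2 * k p.1 7 * T.Omega a p.2) / 2 * ((T.phi p.2)⁻¹) ^ 2)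
      (-k p.1 7 * (T.phi p.2)⁻¹) := by
  have h0 : T.phi p.2 ≠ 0 := ne_of_gt hp.2
  have hi := (HasJet.phi (T := T) (a := a) (p := p)).inv h0
  have hc := HasJet.coeff (T := T) (a := a) hk hp.1
  unfold compC₂C
  simp only [div_eq_mul_inv]
  apply HasJet.of_eq
  · with_reducible repeat' first
      | exact HasJet.phi
      | exact HasJet.psi
      | exact hc _
      | exact hi
      | exact HasJet.const _
      | apply HasJet.pow
      | apply HasJet.add
      | apply HasJet.sub
      | apply HasJet.mul
  all_goals ring

end TwoPlaneSystem

/-! ### The form `γ` of the explicit section -/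

namespace TwoPlaneSystem

/-- The component `Ω([∂₁ + F∂₁, ∂₂ + F∂₂], c)` for the explicit section, where `κ₁, κ₂` are the
partial derivatives of `κ`. -/
def bracketA (K : ℝ) (κ κ₁ κ₂ : Fin 9 → ℝ) (s t : ℝ) : ℝ :=
  compA₂ 0 κ₁ s t + compA₁ κ s t * compA₂A K κ s t + compC₁ κ s t * compA₂C K κ s t
    - (compA₁ κ₂ s t + compA₂ K κ s t * compA₁A κ s t + compC₂ K κ s t * compA₁C κ s t)

/-- The component `Ω(a, [∂₁ + F∂₁, ∂₂ + F∂₂])` for the explicit section, where `κ₁, κ₂` are the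
partial derivatives of `κ`. -/
def bracketC (K : ℝ) (κ κ₁ κ₂ : Fin 9 → ℝ) (s t : ℝ) : ℝ :=
  compC₂ 0 κ₁ s t + compA₁ κ s t * compC₂A K κ s t + compC₁ κ s t * compC₂C K κ s t
    - (compC₁ κ₂ s t + compA₂ K κ s t * compC₁A κ s t + compC₂ K κ s t * compC₁C κ s t)

/-- The value of `γ` on `a`. -/
def gammaA (K : ℝ) (κ : Fin 9 → ℝ) (s t : ℝ) : ℝ :=
  (κ 0 - κ 4 * t - κ 5 * s ^ 2 + κ 7 * t ^ 2 - K * s ^ 2 * t) / 4 - κ 8 * s ^ 2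

/-- The value of `γ` on `c`. -/
def gammaC (K : ℝ) (κ : Fin 9 → ℝ) (s t : ℝ) : ℝ :=
  (K * s ^ 3 + κ 4 * s - 2 * κ 6 * s ^ 2 - 2 * κ 7 * s * t) / 4

/-! ### The equations of the theorem in coordinates -/

/-- The coefficient of `φ³` in the first equation, as left-hand minus right-hand side. -/
def eqnAA (K : ℝ) (κ κ₁ κ₂ : Fin 9 → ℝ) : ℝ :=
  2 * κ₁ 5 - κ₂ 2 + 4 * κ 2 * κ 6 - 4 * κ 3 * κ 5 + 2 * K * κ 1

/-- The coefficient of `φ² Ω(a, X)` in the first equation. -/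
def eqnAC (K : ℝ) (κ κ₁ κ₂ : Fin 9 → ℝ) : ℝ :=
  4 * κ₁ 6 - 2 * κ₂ 3 + 4 * κ 2 * κ 7 - 4 * κ 4 * κ 5 - 2 * K * κ 0

/-- The coefficient of `φ Ω(a, X)²` in the first equation. -/
def eqnCC (κ κ₁ κ₂ : Fin 9 → ℝ) : ℝ :=
  2 * κ₁ 7 - κ₂ 4 + 4 * κ 3 * κ 7 - 4 * κ 4 * κ 6

/-- The coefficient of `Ω(a, X)` in the second equation. -/
def eqnC (κ κ₁ κ₂ : Fin 9 → ℝ) : ℝ :=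
  1 + κ₁ 4 - 4 * κ 6 * κ 0 - 4 * κ 7 * κ 1 - 2 * κ₂ 0

/-- The value of `s` resulting from the second equation of the theorem. -/
def solS (κ κ₁ κ₂ : Fin 9 → ℝ) : ℝ :=
  4 * (κ 5 * κ 0 + κ 6 * κ 1) - (κ 2 * κ 4 - κ 3 ^ 2) - κ₁ 3 - 2 * κ₂ 1

/-- The derivative of `solS`, where `κ', κ₁', κ₂'` are the derivatives of `κ, κ₁, κ₂`. -/
def solS' (κ κ' κ₁' κ₂' : Fin 9 → ℝ) : ℝ :=
  4 * (κ' 5 * κ 0 + κ 5 * κ' 0 + κ' 6 * κ 1 + κ 6 * κ' 1)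
    - (κ' 2 * κ 4 + κ 2 * κ' 4 - 2 * κ 3 * κ' 3) - κ₁' 3 - 2 * κ₂' 1

/-- The left-hand side minus the right-hand side of the third equation, with `solS` for `s`. -/
def eqnS (K : ℝ) (κ κ₁ κ₂ κ₁₂ κ₂₂ : Fin 9 → ℝ) : ℝ :=
  K * κ₁ 0 + solS' κ κ₂ κ₁₂ κ₂₂ - 2 * K * (κ 3 * κ 0 + κ 4 * κ 1) - 8 * κ 8

/-- The derivative of `eqnAA`, where `κ', κ₁', κ₂'` are the derivatives of `κ, κ₁, κ₂`. -/
def eqnAA' (K : ℝ) (κ κ' κ₁' κ₂' : Fin 9 → ℝ) : ℝ :=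
  2 * κ₁' 5 - κ₂' 2 + 4 * (κ' 2 * κ 6 + κ 2 * κ' 6) - 4 * (κ' 3 * κ 5 + κ 3 * κ' 5)
    + 2 * K * κ' 1

/-- The derivative of `eqnAC`, where `κ', κ₁', κ₂'` are the derivatives of `κ, κ₁, κ₂`. -/
def eqnAC' (K : ℝ) (κ κ' κ₁' κ₂' : Fin 9 → ℝ) : ℝ :=
  4 * κ₁' 6 - 2 * κ₂' 3 + 4 * (κ' 2 * κ 7 + κ 2 * κ' 7) - 4 * (κ' 4 * κ 5 + κ 4 * κ' 5)
    - 2 * K * κ' 0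

/-- The derivative of `eqnCC`, where `κ', κ₁', κ₂'` are the derivatives of `κ, κ₁, κ₂`. -/
def eqnCC' (κ κ' κ₁' κ₂' : Fin 9 → ℝ) : ℝ :=
  2 * κ₁' 7 - κ₂' 4 + 4 * (κ' 3 * κ 7 + κ 3 * κ' 7) - 4 * (κ' 4 * κ 6 + κ 4 * κ' 6)

/-- The derivative of `eqnC`, where `κ', κ₁', κ₂'` are the derivatives of `κ, κ₁, κ₂`. -/
def eqnC' (κ κ' κ₁' κ₂' : Fin 9 → ℝ) : ℝ :=
  κ₁' 4 - 4 * (κ' 6 * κ 0 + κ 6 * κ' 0) - 4 * (κ' 7 * κ 1 + κ 7 * κ' 1) - 2 * κ₂' 0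

variable {E P S : Type*} [NormedAddCommGroup E] [NormedSpace ℝ E]
  [NormedAddCommGroup P] [NormedSpace ℝ P] [MetricSpace S] [NormedAddTorsor E S]
  {T : TwoPlaneSystem E P} {a : P} {U : Set S} {F : S × P → E →L[ℝ] P} {p : S × P}
  {k : S → Fin 9 → ℝ} {K : ℝ}

theorem gamma_eq_explicit (ha : T.Omega a T.c = 1) (hU : IsOpen U)
    (hk : AffSmoothOn (W := E) k U)
    (hF : ∀ p ∈ U ×ˢ T.halfPlane,
      T.Omega (F p T.d1) T.c = compA₁ (k p.1) (T.phi p.2) (T.Omega a p.2) ∧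
      T.Omega a (F p T.d1) = compC₁ (k p.1) (T.phi p.2) (T.Omega a p.2) ∧
      T.Omega (F p T.d2) T.c = compA₂ K (k p.1) (T.phi p.2) (T.Omega a p.2) ∧
      T.Omega a (F p T.d2) = compC₂ K (k p.1) (T.phi p.2) (T.Omega a p.2))
    (hp : p ∈ U ×ˢ T.halfPlane) (u : E × P) :
    T.gamma F p u =
      T.xi u.1 * (T.phi p.2 / 2 *
        (T.phi p.2 * bracketC K (k p.1) (T.pd1 k p.1) (T.pd2 k p.1) (T.phi p.2) (T.Omega a p.2)
        - T.Omega a p.2 *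
          bracketA K (k p.1) (T.pd1 k p.1) (T.pd2 k p.1) (T.phi p.2) (T.Omega a p.2)))
      + T.tau u.1 * (-(T.phi p.2 / 2) *
        bracketA K (k p.1) (T.pd1 k p.1) (T.pd2 k p.1) (T.phi p.2) (T.Omega a p.2))
      + (T.Omega u.2 T.c - (T.xi u.1 * compA₁ (k p.1) (T.phi p.2) (T.Omega a p.2)
          + T.tau u.1 * compA₂ K (k p.1) (T.phi p.2) (T.Omega a p.2)))
        * gammaA K (k p.1) (T.phi p.2) (T.Omega a p.2)
      + (T.Omega a u.2 - (T.xi u.1 * compC₁ (k p.1) (T.phi p.2) (T.Omega a p.2)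
          + T.tau u.1 * compC₂ K (k p.1) (T.phi p.2) (T.Omega a p.2)))
        * gammaC K (k p.1) (T.phi p.2) (T.Omega a p.2) := by
  have h0 : T.phi p.2 ≠ 0 := ne_of_gt hp.2
  obtain ⟨eA₁, eC₁, eA₂, eC₂⟩ := hF p hp
  rw [gamma_eq ha h0
    (HasJet.congr hU hp (hasJet_compA₁ hk hp) fun p' hp' => (hF p' hp').1)
    (HasJet.congr hU hp (hasJet_compC₁ hk hp) fun p' hp' => (hF p' hp').2.1)
    (HasJet.congr hU hp (hasJet_compA₂ hk hp) fun p' hp' => (hF p' hp').2.2.1)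
    (HasJet.congr hU hp (hasJet_compC₂ hk hp) fun p' hp' => (hF p' hp').2.2.2)
    eA₁ eC₁ eA₂ eC₂ u]
  generalize T.phi p.2 = x at *
  generalize T.Omega a p.2 = y at *
  generalize k p.1 = κ at *
  -- The pole of order one in `φ` left by `compC₂` and its derivative is cancelled by the factor
  -- `φ/4`, so `γ` has polynomial values on `a` and `c`.
  have hA : x / 4 * (compA₁A κ x y + x * compC₂A K κ x y - y * compA₂A K κ x y - compC₂ K κ x y)
      = gammaA K κ x y := by
    simp only [compA₁A, compC₂A, compA₂A, compC₂, gammaA]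
    field_simp
    ring
  have hC : x / 4 * (compA₁C κ x y + x * compC₂C K κ x y - y * compA₂C K κ x y + compA₂ K κ x y)
      = gammaC K κ x y := by
    simp only [compA₁C, compC₂C, compA₂C, compA₂, gammaC]
    field_simp
    ring
  rw [hA, hC]
  rfl

end TwoPlaneSystem

/-! ### Condition (d) at a point for the explicit section -/

namespace TwoPlaneSystem

variable {E P S : Type*} [NormedAddCommGroup E] [NormedSpace ℝ E]
  [NormedAddCommGroup P] [NormedSpace ℝ P] [MetricSpace S] [NormedAddTorsor E S]
  {T : TwoPlaneSystem E P} {a : P} {U : Set S} {F : S × P → E →L[ℝ] P} {p : S × P}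
  {k : S → Fin 9 → ℝ} {K : ℝ}

theorem hasJet_gammaA (hk : AffSmoothOn (W := E) k U) (hp : p ∈ U ×ˢ T.halfPlane) :
    T.HasJet a (fun p' => gammaA K (k p'.1) (T.phi p'.2) (T.Omega a p'.2)) p
      (gammaA 0 (T.pd1 k p.1) (T.phi p.2) (T.Omega a p.2))
      (gammaA 0 (T.pd2 k p.1) (T.phi p.2) (T.Omega a p.2))
      (-(k p.1 5 + K * T.Omega a p.2) * T.phi p.2 / 2 - 2 * k p.1 8 * T.phi p.2)
      ((2 * k p.1 7 * T.Omega a p.2 - k p.1 4 - K * T.phi p.2 ^ 2) / 4) := by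
  have hc := HasJet.coeff (T := T) (a := a) hk hp.1
  unfold gammaA
  simp only [div_eq_mul_inv]
  apply HasJet.of_eq
  · with_reducible repeat' first
      | exact HasJet.phi
      | exact HasJet.psi
      | exact hc _
      | exact HasJet.const _
      | apply HasJet.pow
      | apply HasJet.add
      | apply HasJet.sub
      | apply HasJet.mul
  all_goals ring

theorem hasJet_gammaC (hk : AffSmoothOn (W := E) k U) (hp : p ∈ U ×ˢ T.halfPlane) :
    T.HasJet a (fun p' => gammaC K (k p'.1) (T.phi p'.2) (T.Omega a p'.2)) p
      (gammaC 0 (T.pd1 k p.1) (T.phi p.2) (T.Omega a p.2))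
      (gammaC 0 (T.pd2 k p.1) (T.phi p.2) (T.Omega a p.2))
      ((3 * K * T.phi p.2 ^ 2 + k p.1 4 - 4 * k p.1 6 * T.phi p.2
        - 2 * k p.1 7 * T.Omega a p.2) / 4)
      (-k p.1 7 * T.phi p.2 / 2) := by
  have hc := HasJet.coeff (T := T) (a := a) hk hp.1
  unfold gammaC
  simp only [div_eq_mul_inv]
  apply HasJet.of_eq
  · with_reducible repeat' first
      | exact HasJet.phi
      | exact HasJet.psi
      | exact hc _
      | exact HasJet.const _
      | apply HasJet.pow
      | apply HasJet.add
      | apply HasJet.sub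
      | apply HasJet.mul
  all_goals ring

theorem AffSmoothOn.pd1 {G : Type*} [NormedAddCommGroup G] [NormedSpace ℝ G] {f : S → G}
    (hf : AffSmoothOn (W := E) f U) : AffSmoothOn (W := E) (T.pd1 f) U :=
  hf.affDeriv_apply T.d1

theorem AffSmoothOn.pd2 {G : Type*} [NormedAddCommGroup G] [NormedSpace ℝ G] {f : S → G}
    (hf : AffSmoothOn (W := E) f U) : AffSmoothOn (W := E) (T.pd2 f) U :=
  hf.affDeriv_apply T.d2

-- The first four equations form a triangular system in `eqnCC`, `eqnC`, `eqnAC`, `eqnAA`, solvable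
-- in this order from the fourth up to the first, as `φ ≠ 0`. Only the fifth contains second
-- derivatives of the coefficients; it is arranged so that everything except the `eqnS` term is a
-- multiple of one of the four expressions or of a derivative of one.
set_option maxHeartbeats 4000000 in
theorem condD_at_explicit_iff (ha : T.Omega a T.c = 1) (hU : IsOpen U)
    (hk : AffSmoothOn (W := E) k U)
    (hF : ∀ p ∈ U ×ˢ T.halfPlane,
      T.Omega (F p T.d1) T.c = compA₁ (k p.1) (T.phi p.2) (T.Omega a p.2) ∧
      T.Omega a (F p T.d1) = compC₁ (k p.1) (T.phi p.2) (T.Omega a p.2) ∧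
      T.Omega (F p T.d2) T.c = compA₂ K (k p.1) (T.phi p.2) (T.Omega a p.2) ∧
      T.Omega a (F p T.d2) = compC₂ K (k p.1) (T.phi p.2) (T.Omega a p.2))
    (hp : p ∈ U ×ˢ T.halfPlane) {x y : ℝ} (hx : T.phi p.2 = x) (hy : T.Omega a p.2 = y)
    {κ κ₁ κ₂ κ₁₁ κ₁₂ κ₂₂ : Fin 9 → ℝ} (h : k p.1 = κ) (h₁ : T.pd1 k p.1 = κ₁)
    (h₂ : T.pd2 k p.1 = κ₂) (h₁₁ : T.pd1 (T.pd1 k) p.1 = κ₁₁)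
    (h₁₂ : T.pd1 (T.pd2 k) p.1 = κ₁₂) (h₂₂ : T.pd2 (T.pd2 k) p.1 = κ₂₂) :
    (∀ (z : E × P) (w : E), extDerivOne (T.gamma F) p z (lift F p w)
        + 2 * wedgeOne (T.alpha F p) (T.gamma F p) z (lift F p w)
      = T.metric F p z (lift F p w) / 2) ↔
    x ^ 2 / 2 * eqnAA K κ κ₁ κ₂ - y ^ 2 / 2 * eqnCC κ κ₁ κ₂ + y / 2 * eqnC κ κ₁ κ₂ = 0 ∧
    x ^ 2 / 2 * eqnAC K κ κ₁ κ₂ + x * y * eqnCC κ κ₁ κ₂ - x / 2 * eqnC κ κ₁ κ₂ = 0 ∧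
    -y / 2 * eqnCC κ κ₁ κ₂ + 1 / 2 * eqnC κ κ₁ κ₂ = 0 ∧
    x / 2 * eqnCC κ κ₁ κ₂ = 0 ∧
    x / 2 * (-x ^ 2 * eqnAA' K κ κ₂ κ₁₂ κ₂₂ - x * y * eqnAC' K κ κ₂ κ₁₂ κ₂₂
      - y ^ 2 * eqnCC' κ κ₂ κ₁₂ κ₂₂ + y * eqnC' κ κ₂ κ₁₂ κ₂₂
      + x / 2 * eqnAC' K κ κ₁ κ₁₁ κ₁₂ + y * eqnCC' κ κ₁ κ₁₁ κ₁₂ - eqnC' κ κ₁ κ₁₁ κ₁₂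
      - x * eqnS K κ κ₁ κ₂ κ₁₂ κ₂₂)
      + (κ 6 * x + κ 7 * y - κ 4 / 2) * x ^ 2 * eqnAA K κ κ₁ κ₂
      + (κ 0 - κ 4 * y - κ 5 * x ^ 2 + κ 7 * y ^ 2 + 4 * x ^ 2 * κ 8) * x / 2 * eqnAC K κ κ₁ κ₂
      + (κ 2 * x / 2 + κ 3 * y - κ 5 * x * y - κ 6 * y ^ 2 + κ 1 + 4 * x * y * κ 8) * x
        * eqnCC κ κ₁ κ₂
      - 4 * x ^ 2 * κ 8 * eqnC κ κ₁ κ₂ = 0 := by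
  -- The fifth identity holds only after the two mixed second derivatives are identified.
  have h₂₁ : T.pd2 (T.pd1 k) p.1 = κ₁₂ := (hk.affDeriv_comm hp.1 T.d1 T.d2).trans h₁₂
  have hk₁ := AffSmoothOn.pd1 (T := T) hk
  have hk₂ := AffSmoothOn.pd2 (T := T) hk
  have hbA : T.HasJet a (fun p' => bracketA K (k p'.1) (T.pd1 k p'.1) (T.pd2 k p'.1)
      (T.phi p'.2) (T.Omega a p'.2)) p _ _ _ _ :=
    (((hasJet_compA₂ hk₁ hp).add ((hasJet_compA₁ hk hp).mul (hasJet_compA₂A hk hp))).add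
      ((hasJet_compC₁ hk hp).mul (hasJet_compA₂C hk hp))).sub
    (((hasJet_compA₁ hk₂ hp).add ((hasJet_compA₂ hk hp).mul (hasJet_compA₁A hk hp))).add
      ((hasJet_compC₂ hk hp).mul (hasJet_compA₁C hk hp)))
  have hbC : T.HasJet a (fun p' => bracketC K (k p'.1) (T.pd1 k p'.1) (T.pd2 k p'.1)
      (T.phi p'.2) (T.Omega a p'.2)) p _ _ _ _ :=
    (((hasJet_compC₂ hk₁ hp).add ((hasJet_compA₁ hk hp).mul (hasJet_compC₂A hk hp))).add
      ((hasJet_compC₁ hk hp).mul (hasJet_compC₂C hk hp))).sub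
    (((hasJet_compC₁ hk₂ hp).add ((hasJet_compA₂ hk hp).mul (hasJet_compC₁A hk hp))).add
      ((hasJet_compC₂ hk hp).mul (hasJet_compC₁C hk hp)))
  have hφ : T.HasJet a (fun p' : S × P => T.phi p'.2 / 2) p 0 0 (1 / 2) 0 := by
    simpa only [div_eq_mul_inv] using
      (HasJet.phi.mul (HasJet.const (2 : ℝ)⁻¹)).of_eq (by ring) (by ring) (by ring) (by ring)
  refine (condD_at_iff ha hU hp hF
    (fun p' hp' u => gamma_eq_explicit ha hU hk hF hp' u)
    (hasJet_compA₁ hk hp) (hasJet_compC₁ hk hp) (hasJet_compA₂ hk hp) (hasJet_compC₂ hk hp)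
    (hφ.mul ((HasJet.phi.mul hbC).sub (HasJet.psi.mul hbA))) (hφ.neg.mul hbA)
    (hasJet_gammaA hk hp) (hasJet_gammaC hk hp) hx hy rfl rfl).trans ?_
  have hx0 : x ≠ 0 := hx ▸ ne_of_gt hp.2
  -- The jet of the coefficients now enters through unrelated real parameters, and each component is
  -- a rational identity in them and in `x ≠ 0`, `y`, `K`.
  simp only [hx, hy, h, h₁, h₂, h₁₁, h₁₂, h₂₁, h₂₂]
  clear hbA hbC hφ hF hk hk₁ hk₂ h₂₁ h₁₂ h₁₁ h₂₂ h₁ h₂ h hx hy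
  refine and_congr (Eq.congr ?_ rfl) (and_congr (Eq.congr ?_ rfl) (and_congr (Eq.congr ?_ rfl)
    (and_congr (Eq.congr ?_ rfl) (Eq.congr ?_ rfl))))
  · simp only [bracketA, bracketC, gammaA, gammaC, compA₁, compA₁A, compA₁C, compC₁,
      compC₁A, compC₁C, compA₂, compA₂A, compA₂C, compC₂, compC₂A, compC₂C, eqnAA, eqnCC, eqnC]
    field_simp
    ring
  · simp only [bracketA, bracketC, gammaA, gammaC, compA₁, compA₁A, compA₁C, compC₁,
      compC₁A, compC₁C, compA₂, compA₂A, compA₂C, compC₂, compC₂A, compC₂C, eqnAC, eqnCC, eqnC]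
    field_simp
    ring
  · simp only [bracketA, gammaA, gammaC, compA₁, compA₁A, compA₁C, compC₁,
      compC₁A, compA₂, compA₂A, compA₂C, compC₂, compC₂A, eqnCC, eqnC]
    field_simp
    ring
  · simp only [bracketA, gammaA, gammaC, compA₁, compA₁A, compA₁C, compC₁,
      compC₁C, compA₂, compA₂A, compA₂C, compC₂, compC₂C, eqnCC]
    field_simp
    ring
  · simp only [bracketA, bracketC, gammaA, gammaC, compA₁, compA₁A, compA₁C, compC₁,
      compC₁A, compC₁C, compA₂, compA₂A, compA₂C, compC₂, compC₂A, compC₂C, eqnAA, eqnAC, eqnCC, eqnC,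
      eqnAA', eqnAC', eqnCC', eqnC', eqnS, solS']
    field_simp
    ring

end TwoPlaneSystem

/-! ### From the pointwise equations to differential equations on `U` -/

namespace TwoPlaneSystem

variable {E P S : Type*} [NormedAddCommGroup E] [NormedSpace ℝ E]
  [NormedAddCommGroup P] [NormedSpace ℝ P] [MetricSpace S] [NormedAddTorsor E S]
  {T : TwoPlaneSystem E P} {a : P} {U : Set S} {F : S × P → E →L[ℝ] P} {p : S × P}
  {k : S → Fin 9 → ℝ} {K : ℝ}

theorem HasJet.unique {f : S × P → ℝ} {d₁ d₂ dA dC e₁ e₂ eA eC : ℝ}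
    (hd : T.HasJet a f p d₁ d₂ dA dC) (he : T.HasJet a f p e₁ e₂ eA eC) : d₁ = e₁ ∧ d₂ = e₂ := by
  have h := fun u => (hd.affDeriv_apply u).symm.trans (he.affDeriv_apply u)
  exact ⟨by simpa [T.d1_spec] using h (T.d1, 0), by simpa [T.d2_spec] using h (T.d2, 0)⟩

/-- This permits differentiating, along `Σ`, an equation known to hold on all of `U × Π₊`. -/
theorem HasJet.eq_zero (hU : IsOpen U) (hp : p ∈ U ×ˢ T.halfPlane) {f : S × P → ℝ}
    {d₁ d₂ dA dC : ℝ} (hd : T.HasJet a f p d₁ d₂ dA dC) (hf : ∀ p' ∈ U ×ˢ T.halfPlane, f p' = 0) :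
    d₁ = 0 ∧ d₂ = 0 :=
  hd.unique (HasJet.congr hU hp (HasJet.const 0) hf)

theorem hasJet_eqnAA (hk : AffSmoothOn (W := E) k U) (hp : p.1 ∈ U) :
    T.HasJet a (fun p' => eqnAA K (k p'.1) (T.pd1 k p'.1) (T.pd2 k p'.1)) p
      (eqnAA' K (k p.1) (T.pd1 k p.1) (T.pd1 (T.pd1 k) p.1) (T.pd1 (T.pd2 k) p.1))
      (eqnAA' K (k p.1) (T.pd2 k p.1) (T.pd2 (T.pd1 k) p.1) (T.pd2 (T.pd2 k) p.1)) 0 0 := by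
  have hc := HasJet.coeff (T := T) (a := a) hk hp
  have hc₁ := HasJet.coeff (T := T) (a := a) (AffSmoothOn.pd1 (T := T) hk) hp
  have hc₂ := HasJet.coeff (T := T) (a := a) (AffSmoothOn.pd2 (T := T) hk) hp
  unfold eqnAA eqnAA'
  apply HasJet.of_eq
  · with_reducible repeat' first
      | exact hc _
      | exact hc₁ _
      | exact hc₂ _
      | exact HasJet.const _
      | apply HasJet.add
      | apply HasJet.sub
      | apply HasJet.mul
  all_goals ring

theorem hasJet_eqnAC (hk : AffSmoothOn (W := E) k U) (hp : p.1 ∈ U) :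
    T.HasJet a (fun p' => eqnAC K (k p'.1) (T.pd1 k p'.1) (T.pd2 k p'.1)) p
      (eqnAC' K (k p.1) (T.pd1 k p.1) (T.pd1 (T.pd1 k) p.1) (T.pd1 (T.pd2 k) p.1))
      (eqnAC' K (k p.1) (T.pd2 k p.1) (T.pd2 (T.pd1 k) p.1) (T.pd2 (T.pd2 k) p.1)) 0 0 := by
  have hc := HasJet.coeff (T := T) (a := a) hk hp
  have hc₁ := HasJet.coeff (T := T) (a := a) (AffSmoothOn.pd1 (T := T) hk) hp
  have hc₂ := HasJet.coeff (T := T) (a := a) (AffSmoothOn.pd2 (T := T) hk) hp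
  unfold eqnAC eqnAC'
  apply HasJet.of_eq
  · with_reducible repeat' first
      | exact hc _
      | exact hc₁ _
      | exact hc₂ _
      | exact HasJet.const _
      | apply HasJet.add
      | apply HasJet.sub
      | apply HasJet.mul
  all_goals ring

theorem hasJet_eqnCC (hk : AffSmoothOn (W := E) k U) (hp : p.1 ∈ U) :
    T.HasJet a (fun p' => eqnCC (k p'.1) (T.pd1 k p'.1) (T.pd2 k p'.1)) p
      (eqnCC' (k p.1) (T.pd1 k p.1) (T.pd1 (T.pd1 k) p.1) (T.pd1 (T.pd2 k) p.1))
      (eqnCC' (k p.1) (T.pd2 k p.1) (T.pd2 (T.pd1 k) p.1) (T.pd2 (T.pd2 k) p.1)) 0 0 := by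
  have hc := HasJet.coeff (T := T) (a := a) hk hp
  have hc₁ := HasJet.coeff (T := T) (a := a) (AffSmoothOn.pd1 (T := T) hk) hp
  have hc₂ := HasJet.coeff (T := T) (a := a) (AffSmoothOn.pd2 (T := T) hk) hp
  unfold eqnCC eqnCC'
  apply HasJet.of_eq
  · with_reducible repeat' first
      | exact hc _
      | exact hc₁ _
      | exact hc₂ _
      | exact HasJet.const _
      | apply HasJet.add
      | apply HasJet.sub
      | apply HasJet.mul
  all_goals ring

theorem hasJet_eqnC (hk : AffSmoothOn (W := E) k U) (hp : p.1 ∈ U) :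
    T.HasJet a (fun p' => eqnC (k p'.1) (T.pd1 k p'.1) (T.pd2 k p'.1)) p
      (eqnC' (k p.1) (T.pd1 k p.1) (T.pd1 (T.pd1 k) p.1) (T.pd1 (T.pd2 k) p.1))
      (eqnC' (k p.1) (T.pd2 k p.1) (T.pd2 (T.pd1 k) p.1) (T.pd2 (T.pd2 k) p.1)) 0 0 := by
  have hc := HasJet.coeff (T := T) (a := a) hk hp
  have hc₁ := HasJet.coeff (T := T) (a := a) (AffSmoothOn.pd1 (T := T) hk) hp
  have hc₂ := HasJet.coeff (T := T) (a := a) (AffSmoothOn.pd2 (T := T) hk) hp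
  unfold eqnC eqnC'
  apply HasJet.of_eq
  · with_reducible repeat' first
      | exact hc _
      | exact hc₁ _
      | exact hc₂ _
      | exact HasJet.const _
      | apply HasJet.add
      | apply HasJet.sub
      | apply HasJet.mul
  all_goals ring

theorem affSmoothOn_solS (hk : AffSmoothOn (W := E) k U) :
    AffSmoothOn (W := E) (fun y => solS (k y) (T.pd1 k y) (T.pd2 k y)) U := by
  intro y hy
  have hc := fun i : Fin 9 => contDiffAt_pi.1 (hk y hy) i
  have hc₁ := fun i : Fin 9 => contDiffAt_pi.1 (AffSmoothOn.pd1 (T := T) hk y hy) i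
  have hc₂ := fun i : Fin 9 => contDiffAt_pi.1 (AffSmoothOn.pd2 (T := T) hk y hy) i
  simp only [solS]
  exact (((contDiffAt_const.mul (((hc 5).mul (hc 0)).add ((hc 6).mul (hc 1)))).sub
    (((hc 2).mul (hc 4)).sub ((hc 3).pow 2))).sub (hc₁ 3)).sub (contDiffAt_const.mul (hc₂ 1))

theorem hasJet_solS (hk : AffSmoothOn (W := E) k U) (hp : p.1 ∈ U) :
    T.HasJet a (fun p' => solS (k p'.1) (T.pd1 k p'.1) (T.pd2 k p'.1)) p
      (solS' (k p.1) (T.pd1 k p.1) (T.pd1 (T.pd1 k) p.1) (T.pd1 (T.pd2 k) p.1))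
      (solS' (k p.1) (T.pd2 k p.1) (T.pd2 (T.pd1 k) p.1) (T.pd2 (T.pd2 k) p.1)) 0 0 := by
  have hc := HasJet.coeff (T := T) (a := a) hk hp
  have hc₁ := HasJet.coeff (T := T) (a := a) (AffSmoothOn.pd1 (T := T) hk) hp
  have hc₂ := HasJet.coeff (T := T) (a := a) (AffSmoothOn.pd2 (T := T) hk) hp
  unfold solS solS'
  apply HasJet.of_eq
  · with_reducible repeat' first
      | exact hc _
      | exact hc₁ _
      | exact hc₂ _
      | exact HasJet.const _
      | apply HasJet.pow
      | apply HasJet.add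
      | apply HasJet.sub
      | apply HasJet.mul
  all_goals ring

theorem pd2_solS (hk : AffSmoothOn (W := E) k U) {y : S} (hy : y ∈ U) :
    T.pd2 (fun y => solS (k y) (T.pd1 k y) (T.pd2 k y)) y =
      solS' (k y) (T.pd2 k y) (T.pd1 (T.pd2 k) y) (T.pd2 (T.pd2 k) y) := by
  have e : T.pd2 (T.pd1 k) y = T.pd1 (T.pd2 k) y := hk.affDeriv_comm hy T.d1 T.d2
  -- The function comes from the base, so any fibre point will do; two of its jets there are
  -- compared.
  have hp : ((y, 0) : S × P).1 ∈ U := hy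
  rw [← e]
  exact ((HasJet.of_base (a := 0) (affSmoothOn_solS hk) hp).unique (hasJet_solS hk hp)).2

/-- A single fibre point, `X = a`, already yields all the equations on `U`; conversely, they imply
(d) at every fibre point, as the remaining terms are multiples of expressions that vanish on `U`
together with their derivatives. -/
theorem condD_explicit_iff (ha : T.Omega a T.c = 1) (hU : IsOpen U)
    (hk : AffSmoothOn (W := E) k U)
    (hF : ∀ p ∈ U ×ˢ T.halfPlane,
      T.Omega (F p T.d1) T.c = compA₁ (k p.1) (T.phi p.2) (T.Omega a p.2) ∧
      T.Omega a (F p T.d1) = compC₁ (k p.1) (T.phi p.2) (T.Omega a p.2) ∧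
      T.Omega (F p T.d2) T.c = compA₂ K (k p.1) (T.phi p.2) (T.Omega a p.2) ∧
      T.Omega a (F p T.d2) = compC₂ K (k p.1) (T.phi p.2) (T.Omega a p.2)) :
    T.CondD F U ↔
      (∀ y ∈ U, eqnAA K (k y) (T.pd1 k y) (T.pd2 k y) = 0 ∧
        eqnAC K (k y) (T.pd1 k y) (T.pd2 k y) = 0 ∧ eqnCC (k y) (T.pd1 k y) (T.pd2 k y) = 0 ∧
        eqnC (k y) (T.pd1 k y) (T.pd2 k y) = 0) ∧
      ∀ y ∈ U, eqnS K (k y) (T.pd1 k y) (T.pd2 k y) (T.pd1 (T.pd2 k) y) (T.pd2 (T.pd2 k) y)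
        = 0 := by
  have hpt := fun (p : S × P) (hp : p ∈ U ×ˢ T.halfPlane) =>
    condD_at_explicit_iff ha hU hk hF hp rfl rfl rfl rfl rfl rfl rfl rfl
  have hder : (∀ y ∈ U, eqnAA K (k y) (T.pd1 k y) (T.pd2 k y) = 0 ∧
        eqnAC K (k y) (T.pd1 k y) (T.pd2 k y) = 0 ∧ eqnCC (k y) (T.pd1 k y) (T.pd2 k y) = 0 ∧
        eqnC (k y) (T.pd1 k y) (T.pd2 k y) = 0) → ∀ p ∈ U ×ˢ T.halfPlane, _ := fun h p hp =>
    have e : T.pd2 (T.pd1 k) p.1 = T.pd1 (T.pd2 k) p.1 := hk.affDeriv_comm hp.1 T.d1 T.d2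
    e ▸ And.intro ((hasJet_eqnAA (a := a) hk hp.1).eq_zero hU hp fun p' hp' => (h p'.1 hp'.1).1)
      (And.intro
        ((hasJet_eqnAC (a := a) hk hp.1).eq_zero hU hp fun p' hp' => (h p'.1 hp'.1).2.1)
        (And.intro
          ((hasJet_eqnCC (a := a) hk hp.1).eq_zero hU hp fun p' hp' => (h p'.1 hp'.1).2.2.1)
          ((hasJet_eqnC (a := a) hk hp.1).eq_zero hU hp fun p' hp' => (h p'.1 hp'.1).2.2.2)))
  constructor
  · intro hD
    -- At `X = a` one has `φ = 1` and `ψ = 0`, which reduces the triangular system to its simplest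
    -- form.
    have hmem : ∀ y ∈ U, ((y, a) : S × P) ∈ U ×ˢ T.halfPlane := fun y hy =>
      ⟨hy, show 0 < T.Omega a T.c by rw [ha]; exact one_pos⟩
    have hφ : T.phi a = 1 := ha
    have h0 : ∀ y ∈ U, eqnAA K (k y) (T.pd1 k y) (T.pd2 k y) = 0 ∧
        eqnAC K (k y) (T.pd1 k y) (T.pd2 k y) = 0 ∧ eqnCC (k y) (T.pd1 k y) (T.pd2 k y) = 0 ∧
        eqnC (k y) (T.pd1 k y) (T.pd2 k y) = 0 := by
      intro y hy
      obtain ⟨h₁, h₂, h₃, h₄, -⟩ := (hpt _ (hmem y hy)).1 (hD _ (hmem y hy))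
      simp only [hφ, T.Omega_self] at h₁ h₂ h₃ h₄
      exact ⟨by linarith, by linarith, by linarith, by linarith⟩
    refine ⟨h0, fun y hy => ?_⟩
    obtain ⟨-, -, -, -, h₅⟩ := (hpt _ (hmem y hy)).1 (hD _ (hmem y hy))
    obtain ⟨⟨-, d₁⟩, ⟨d₂, d₃⟩, ⟨d₄, d₅⟩, ⟨d₆, d₇⟩⟩ := hder h0 _ (hmem y hy)
    obtain ⟨e₁, e₂, e₃, e₄⟩ := h0 y hy
    -- Only `-eqnS/2` survives on the left-hand side.
    simp only [hφ, T.Omega_self, e₁, e₂, e₃, e₄, d₁, d₂, d₃, d₄, d₅, d₆, d₇] at h₅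
    linarith
  · rintro ⟨h0, hS⟩ p hp
    rw [hpt p hp]
    obtain ⟨⟨-, d₁⟩, ⟨d₂, d₃⟩, ⟨d₄, d₅⟩, ⟨d₆, d₇⟩⟩ := hder h0 p hp
    obtain ⟨e₁, e₂, e₃, e₄⟩ := h0 p.1 hp.1
    simp [e₁, e₂, e₃, e₄, d₁, d₂, d₃, d₄, d₅, d₆, d₇, hS p.1 hp.1]

end TwoPlaneSystem

/-! ### Components of `q, λ, μ, r` in the basis `a, c` -/

namespace TwoPlaneSystem

variable {E P S : Type*} [NormedAddCommGroup E] [NormedSpace ℝ E]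
  [NormedAddCommGroup P] [NormedSpace ℝ P]
  {T : TwoPlaneSystem E P} {a : P}

theorem bilin_eq_coord (ha : T.Omega a T.c = 1) (b : P →L[ℝ] P →L[ℝ] ℝ) (u v : P)
    (hb : b T.c a = b a T.c) :
    b u v = T.Omega u T.c * T.Omega v T.c * b a a
      + (T.Omega u T.c * T.Omega a v + T.Omega a u * T.Omega v T.c) * b a T.c
      + T.Omega a u * T.Omega a v * b T.c T.c := by
  conv_lhs => rw [T.eq_smul_add_smul ha u, T.eq_smul_add_smul ha v]
  simp only [map_add, map_smul, add_apply, smul_apply, smul_eq_mul, hb]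
  ring

/-- In the basis `a, c` the matrix of `Ω` has determinant `1`, since `Ω(a, c) = 1`. -/
theorem detOmega_eq_coord (ha : T.Omega a T.c = 1) (b : P →L[ℝ] P →L[ℝ] ℝ)
    (hb : b T.c a = b a T.c) : T.detOmega b = b a a * b T.c T.c - b a T.c ^ 2 := by
  have hca : T.Omega T.c a = -1 := by rw [T.Omega_swap, ha]
  have hli : LinearIndependent ℝ ![a, T.c] := by
    rw [LinearIndependent.pair_iff]
    intro s t hst
    have e₁ := congrArg (fun v => T.Omega v T.c) hst
    have e₂ := congrArg (fun v => T.Omega a v) hst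
    simp only [map_add, map_smul, add_apply, smul_apply, T.Omega_self, smul_eq_mul, ha, map_zero,
      zero_apply, mul_one, mul_zero, add_zero, zero_add] at e₁ e₂
    exact ⟨e₁, e₂⟩
  rw [T.detOmega_eq_detRatio
    (basisOfLinearIndependentOfCardEqFinrank hli (by simp [T.finrank_fibre])) b, detRatio]
  simp [Matrix.det_fin_two, T.Omega_self, ha, hca, hb]
  ring

/-- The components of `(q, λ, μ, r)` relative to the basis `a, c` of `Π`. -/
def coeffs (T : TwoPlaneSystem E P) (a : P) (q : P) (lam mu : P →L[ℝ] P →L[ℝ] ℝ) (r : ℝ) :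
    Fin 9 → ℝ :=
  ![T.Omega q T.c, T.Omega a q, lam a a, lam a T.c, lam T.c T.c, mu a a, mu a T.c, mu T.c T.c, r]

theorem explicitF_coord (ha : T.Omega a T.c = 1) (K : ℝ) (q : P) (lam mu : P →L[ℝ] P →L[ℝ] ℝ)
    (r : ℝ) (hlam : ∀ u v, lam u v = lam v u) (hmu : ∀ u v, mu u v = mu v u) {x : P}
    (hx : x ∈ T.halfPlane) :
    T.Omega (T.explicitF K q lam mu r x T.d1) T.c =
      compA₁ (T.coeffs a q lam mu r) (T.phi x) (T.Omega a x) ∧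
    T.Omega a (T.explicitF K q lam mu r x T.d1) =
      compC₁ (T.coeffs a q lam mu r) (T.phi x) (T.Omega a x) ∧
    T.Omega (T.explicitF K q lam mu r x T.d2) T.c =
      compA₂ K (T.coeffs a q lam mu r) (T.phi x) (T.Omega a x) ∧
    T.Omega a (T.explicitF K q lam mu r x T.d2) =
      compC₂ K (T.coeffs a q lam mu r) (T.phi x) (T.Omega a x) := by
  have h0 : T.phi x ≠ 0 := ne_of_gt hx
  have hl := bilin_eq_coord ha lam x x (hlam _ _)
  have hl' := bilin_eq_coord ha lam T.c x (hlam _ _)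
  have hm := bilin_eq_coord ha mu x x (hmu _ _)
  have hm' := bilin_eq_coord ha mu T.c x (hmu _ _)
  have hφ : T.Omega x T.c = T.phi x := rfl
  simp only [T.Omega_self, ha, hφ] at hl hl' hm hm'
  simp only [explicitF, FK, Fq, Flam, Fmu, f, zetaVec, Y, coeffs, compA₁, compC₁, compA₂, compC₂,
    T.d1_spec.1, T.d1_spec.2, T.d2_spec.1, T.d2_spec.2, map_add, map_sub, map_smul, add_apply,
    sub_apply, smul_apply, smul_eq_mul, T.Omega_self, ha, hφ, hl, hl', hm, hm']
  simp only [Matrix.cons_val]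
  refine ⟨?_, ?_, ?_, ?_⟩ <;> field_simp <;> ring

variable [MetricSpace S] [NormedAddTorsor E S] {U : Set S} {q : S → P}
  {lam mu : S → P →L[ℝ] P →L[ℝ] ℝ} {r : S → ℝ}

theorem affSmoothOn_coeffs (a : P) (hq : AffSmoothOn (W := E) q U)
    (hlam : AffSmoothOn (W := E) lam U) (hmu : AffSmoothOn (W := E) mu U)
    (hr : AffSmoothOn (W := E) r U) :
    AffSmoothOn (W := E) (fun y => T.coeffs a (q y) (lam y) (mu y) (r y)) U := by
  have ev : ∀ {b : S → P →L[ℝ] P →L[ℝ] ℝ} (u v : P), AffSmoothOn (W := E) b U →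
      AffSmoothOn (W := E) (fun y => b y u v) U := fun u v hb =>
    (hb.clm_comp (ContinuousLinearMap.apply ℝ (P →L[ℝ] ℝ) u)).clm_comp
      (ContinuousLinearMap.apply ℝ ℝ v)
  intro y hy
  rw [contDiffAt_pi]
  intro i
  fin_cases i
  · exact hq.clm_comp (T.Omega.flip T.c) y hy
  · exact hq.clm_comp (T.Omega a) y hy
  · exact ev a a hlam y hy
  · exact ev a T.c hlam y hy
  · exact ev T.c T.c hlam y hy
  · exact ev a a hmu y hy
  · exact ev a T.c hmu y hy
  · exact ev T.c T.c hmu y hy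
  · exact hr y hy

theorem affDeriv_bilin_apply {b : S → P →L[ℝ] P →L[ℝ] ℝ} (hb : AffSmoothOn (W := E) b U) {y : S}
    (hy : y ∈ U) (w : E) (u v : P) :
    affDeriv (fun y' => b y' u v) y w = affDeriv b y w u v := by
  have h₁ := (hb.clm_comp (ContinuousLinearMap.apply ℝ (P →L[ℝ] ℝ) u)).affDeriv_clm
    (ContinuousLinearMap.apply ℝ ℝ v) hy w
  have h₂ := hb.affDeriv_clm (ContinuousLinearMap.apply ℝ (P →L[ℝ] ℝ) u) hy w
  exact h₁.trans (DFunLike.congr_fun h₂ v)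

/-- The symmetry holds throughout the open set `U` and can be differentiated. The derivatives of `λ`
and `μ` thus also have only three components each. -/
theorem affDeriv_bilin_symm (hU : IsOpen U) {b : S → P →L[ℝ] P →L[ℝ] ℝ}
    (hb : AffSmoothOn (W := E) b U) (hs : ∀ y ∈ U, ∀ u v : P, b y u v = b y v u) {y : S}
    (hy : y ∈ U) (w : E) (u v : P) : affDeriv b y w u v = affDeriv b y w v u := by
  rw [← affDeriv_bilin_apply hb hy, ← affDeriv_bilin_apply hb hy]
  exact DFunLike.congr_fun
    (affDeriv_congr ((eventually_vadd_mem hU hy).mono fun _ h => hs _ h u v)) w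

theorem affDeriv_coeffs (a : P) (hq : AffSmoothOn (W := E) q U)
    (hlam : AffSmoothOn (W := E) lam U) (hmu : AffSmoothOn (W := E) mu U)
    (hr : AffSmoothOn (W := E) r U) {y : S} (hy : y ∈ U) (w : E) :
    affDeriv (fun y => T.coeffs a (q y) (lam y) (mu y) (r y)) y w =
      T.coeffs a (affDeriv q y w) (affDeriv lam y w) (affDeriv mu y w) (affDeriv r y w) := by
  have e := fun i => (affSmoothOn_coeffs (T := T) a hq hlam hmu hr).affDeriv_clm
    (ContinuousLinearMap.proj (R := ℝ) (φ := fun _ => ℝ) i) hy w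
  ext i
  refine (e i).symm.trans ?_
  fin_cases i
  · exact hq.affDeriv_clm (T.Omega.flip T.c) hy w
  · exact hq.affDeriv_clm (T.Omega a) hy w
  · exact affDeriv_bilin_apply hlam hy w a a
  · exact affDeriv_bilin_apply hlam hy w a T.c
  · exact affDeriv_bilin_apply hlam hy w T.c T.c
  · exact affDeriv_bilin_apply hmu hy w a a
  · exact affDeriv_bilin_apply hmu hy w a T.c
  · exact affDeriv_bilin_apply hmu hy w T.c T.c
  · rfl

end TwoPlaneSystem

/-! ### The equations of the theorem as polynomial identities on the fibres -/

theorem theorem18p1 {E S P : Type*} [NormedAddCommGroup E] [NormedSpace ℝ E]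
    [NormedAddCommGroup P] [NormedSpace ℝ P] [MetricSpace S] [NormedAddTorsor E S]
    (T : TwoPlaneSystem E P) (K : ℝ) (U : Set S) (hU : IsOpen U)
    (F : S × P → E →L[ℝ] P)
    (hA : T.CondA K F U) (hB : T.CondB K F U) (hC : T.CondC F U)
    (q : S → P) (lam mu : S → P →L[ℝ] P →L[ℝ] ℝ) (r : S → ℝ)
    (hq : AffSmoothOn q U) (hlam : AffSmoothOn lam U) (hmu : AffSmoothOn mu U)
    (hr : AffSmoothOn r U)
    (hlam_symm : ∀ y ∈ U, ∀ u v : P, lam y u v = lam y v u)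
    (hmu_symm : ∀ y ∈ U, ∀ u v : P, mu y u v = mu y v u)
    (hF : ∀ y ∈ U, ∀ x ∈ T.halfPlane, ∀ w : E,
      F (y, x) w = T.explicitF K (q y) (lam y) (mu y) (r y) x w)
    (a : P) (ha : T.Omega a T.c = 1) :
    T.CondD F U ↔
      ∃ s : S → ℝ, AffSmoothOn s U ∧
        (∀ y ∈ U, ∀ x ∈ T.halfPlane,
          (2 * T.pd1 mu y x x - T.pd2 lam y x x) * T.phi x
              = 4 * lam y T.c x * mu y x x - 4 * mu y T.c x * lam y x x
                - 2 * K * T.phi x ^ 2 * T.Omega x (q y) ∧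
          T.pd1 lam y T.c x + 2 * T.Omega x (T.pd2 q y)
              = 4 * mu y (q y) x + T.Omega x a - T.phi x * T.detOmega (lam y) - s y * T.phi x) ∧
        (∀ y ∈ U,
          K * T.Omega (T.pd1 q y) T.c + T.pd2 s y = 2 * K * lam y T.c (q y) + 8 * r y) := by
  open TwoPlaneSystem in
  have hk := affSmoothOn_coeffs (T := T) a hq hlam hmu hr
  rw [condD_explicit_iff ha hU hk fun p hp => by
    obtain ⟨y, x⟩ := p
    rw [hF y hp.1 x hp.2, hF y hp.1 x hp.2]
    exact explicitF_coord ha K _ _ _ _ (hlam_symm y hp.1) (hmu_symm y hp.1) hp.2]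
  set k := fun y => T.coeffs a (q y) (lam y) (mu y) (r y) with hkdef
  have hk₁ : ∀ y ∈ U, T.pd1 k y =
      T.coeffs a (T.pd1 q y) (T.pd1 lam y) (T.pd1 mu y) (T.pd1 r y) :=
    fun y hy => affDeriv_coeffs a hq hlam hmu hr hy T.d1
  have hk₂ : ∀ y ∈ U, T.pd2 k y =
      T.coeffs a (T.pd2 q y) (T.pd2 lam y) (T.pd2 mu y) (T.pd2 r y) :=
    fun y hy => affDeriv_coeffs a hq hlam hmu hr hy T.d2
  -- Along each fibre the first equation is `φ` times a quadratic form in `φ, ψ`.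
  have e₁ : ∀ y ∈ U, ∀ x, (2 * T.pd1 mu y x x - T.pd2 lam y x x) * T.phi x
      - (4 * lam y T.c x * mu y x x - 4 * mu y T.c x * lam y x x
        - 2 * K * T.phi x ^ 2 * T.Omega x (q y)) =
      T.phi x * (T.phi x ^ 2 * eqnAA K (k y) (T.pd1 k y) (T.pd2 k y)
        + T.phi x * T.Omega a x * eqnAC K (k y) (T.pd1 k y) (T.pd2 k y)
        + T.Omega a x ^ 2 * eqnCC (k y) (T.pd1 k y) (T.pd2 k y)) := by
    intro y hy x
    rw [bilin_eq_coord ha (T.pd1 mu y) x x (affDeriv_bilin_symm hU hmu hmu_symm hy _ _ _),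
      bilin_eq_coord ha (T.pd2 lam y) x x (affDeriv_bilin_symm hU hlam hlam_symm hy _ _ _),
      bilin_eq_coord ha (lam y) T.c x (hlam_symm y hy _ _),
      bilin_eq_coord ha (mu y) T.c x (hmu_symm y hy _ _),
      bilin_eq_coord ha (lam y) x x (hlam_symm y hy _ _),
      bilin_eq_coord ha (mu y) x x (hmu_symm y hy _ _), T.Omega_eq_coord ha x (q y), hk₁ y hy,
      hk₂ y hy]
    simp only [hkdef, eqnAA, eqnAC, eqnCC, coeffs, Matrix.cons_val, T.Omega_self, ha, phi]
    ring
  -- The second equation is linear in `φ, ψ`; `s` enters only the coefficient of `φ`.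
  have e₂ : ∀ (s : S → ℝ), ∀ y ∈ U, ∀ x, T.pd1 lam y T.c x + 2 * T.Omega x (T.pd2 q y)
      - (4 * mu y (q y) x + T.Omega x a - T.phi x * T.detOmega (lam y) - s y * T.phi x) =
      T.Omega a x * eqnC (k y) (T.pd1 k y) (T.pd2 k y)
        + T.phi x * (s y - solS (k y) (T.pd1 k y) (T.pd2 k y)) := by
    intro s y hy x
    rw [bilin_eq_coord ha (T.pd1 lam y) T.c x (affDeriv_bilin_symm hU hlam hlam_symm hy _ _ _),
      bilin_eq_coord ha (mu y) (q y) x (hmu_symm y hy _ _),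
      detOmega_eq_coord ha (lam y) (hlam_symm y hy _ _), T.Omega_eq_coord ha x (T.pd2 q y),
      T.Omega_swap x a, hk₁ y hy, hk₂ y hy]
    simp only [hkdef, eqnC, solS, coeffs, Matrix.cons_val, T.Omega_self, ha, phi]
    ring
  have e₃ : ∀ (s : S → ℝ), ∀ y ∈ U,
      T.pd2 s y = T.pd2 (fun y => solS (k y) (T.pd1 k y) (T.pd2 k y)) y →
      K * T.Omega (T.pd1 q y) T.c + T.pd2 s y - (2 * K * lam y T.c (q y) + 8 * r y) =
      eqnS K (k y) (T.pd1 k y) (T.pd2 k y) (T.pd1 (T.pd2 k) y) (T.pd2 (T.pd2 k) y) := by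
    intro s y hy hs
    rw [hs, pd2_solS hk hy, bilin_eq_coord ha (lam y) T.c (q y) (hlam_symm y hy _ _), hk₁ y hy]
    simp only [hkdef, eqnS, coeffs, Matrix.cons_val, T.Omega_self, ha]
    ring
  constructor
  · rintro ⟨h0, hS⟩
    refine ⟨fun y => solS (k y) (T.pd1 k y) (T.pd2 k y), affSmoothOn_solS hk,
      fun y hy x _ => ?_, fun y hy => ?_⟩
    · obtain ⟨h₁, h₂, h₃, h₄⟩ := h0 y hy
      -- The pattern `_ - _` selects the second equation, the first having right-hand side `0` by
      -- now.
      rw [← sub_eq_zero, e₁ y hy x, ← sub_eq_zero (b := _ - _),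
        e₂ (fun y => solS (k y) (T.pd1 k y) (T.pd2 k y)) y hy x, h₁, h₂, h₃, h₄]
      constructor <;> ring
    · rw [← sub_eq_zero, e₃ _ y hy rfl, hS y hy]
  · rintro ⟨s, -, h, hS⟩
    -- On the line `a + t c` one has `φ = 1` and `ψ = t`. The values `t = 0, 1, -1` recover the
    -- three coefficients of the first equation, and `t = 0, 1` the two of the second.
    have hφ : ∀ t : ℝ, T.phi (a + t • T.c) = 1 := fun t => by simp [phi, ha, T.Omega_self]
    have hψ : ∀ t : ℝ, T.Omega a (a + t • T.c) = t := fun t => by simp [ha, T.Omega_self]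
    have h' : ∀ y ∈ U, ∀ t : ℝ, _ := fun y hy t =>
      have hx : a + t • T.c ∈ T.halfPlane := show 0 < T.phi _ by rw [hφ]; exact one_pos
      And.intro ((e₁ y hy _).symm.trans (sub_eq_zero.2 (h y hy _ hx).1))
        ((e₂ s y hy _).symm.trans (sub_eq_zero.2 (h y hy _ hx).2))
    simp only [hφ, hψ] at h'
    have hs : ∀ y ∈ U, s y = solS (k y) (T.pd1 k y) (T.pd2 k y) := fun y hy => by
      linarith [(h' y hy 0).2]
    refine ⟨fun y hy => ?_, fun y hy => ?_⟩
    · have h₀ := (h' y hy 0).1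
      have h₁ := (h' y hy 1).1
      have h₂ := (h' y hy (-1)).1
      have h₃ := (h' y hy 0).2
      have h₄ := (h' y hy 1).2
      exact ⟨by linarith, by linarith, by linarith, by linarith⟩
    -- Since `s` agrees with `solS` on the open set `U`, so do their derivatives there.
    · rw [← e₃ s y hy (DFunLike.congr_fun (affDeriv_congr
        ((eventually_vadd_mem hU hy).mono fun _ hu => hs _ hu)) T.d2), hS y hy, sub_self]

end
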